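/- Conventions. Let $k$ be a field. All extriangulated categories $(\mathcal E,\mathbb E,\mathfrak s)$ (in the sense of Nakaoka–Palu) are $k$-linear, Hom-finite, Krull–Schmidt and satisfy condition (WIC): if $gf$ is a deflation then so is $g$, and if $gf$ is an inflation then so is $f$. Subcategories are full and closed under isomorphisms, finite direct sums and direct summands. A morphism is *compatible* if it is an isomorphism whenever it is both an inflation and a deflation. A sequence $A\xrightarrow{f}B\xrightarrow{g}C$ is *left exact* if there is an $\mathbb E$-triangle $A\xrightarrow{f}B\xrightarrow{p}K\dashrightarrow$ and a compatible inflation $q:K\to C$ with $g=qp$; *right exact* sequences are defined dually. An additive functor is left (right) exact if it preserves compatible morphisms and left (right) exact sequences, and exact if it preserves compatible morphisms and $\mathbb E$-triangles. A four-term sequence $A\to B\xrightarrow{g} C\to D$ is a left (right) exact $\mathbb E$-triangle sequence if there are $\mathbb E$-triangles $A\to B\xrightarrow{p}K\dashrightarrow$ and $K\xrightarrow{q}C\to D\dashrightarrow$ with $g=qp$ and $q$ (resp. $p$) compatible. A *recollement* $(\mathcal A,\mathcal B,\mathcal C)$ consists of exact functors $i_*:\mathcal A\to\mathcal B$, $j^*:\mathcal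 B\to\mathcal C$, right exact functors $i^*:\mathcal B\to\mathcal A$, $j_!:\mathcal C\to\mathcal B$ and left exact functors $i^!:\mathcal B\to\mathcal A$, $j_*:\mathcal C\to\mathcal B$ such that $(i^*,i_*,i^!)$ and $(j_!,j^*,j_*)$ are adjoint triples, $\operatorname{Im} i_*=\operatorname{Ker} j^*$ (essential image), $i_*,j_!,j_*$ are fully faithful, and every $X\in\mathcal B$ admits a left exact $\mathbb E_{\mathcal B}$-triangle sequence $i_*i^!X\to X\to j_*j^*X\to i_*A$ and a right exact $\mathbb E_{\mathcal B}$-triangle sequence $i_*A'\to j_!j^*X\to X\to i_*i^*X$ with $A,A'\in\mathcal A$, where the maps to and from $X$ are the adjunction morphisms. Put $\mathbb E^{n+1}(X,Y)=\mathbb E(\Omega^nX,Y)$. For a subcategory $\mathcal T$ let $\mathcal T^\wedge_0=\mathcal T^\vee_0=\mathcal T$, let $\mathcal T^\wedge_{n+1}$ be the class of $Z$ admitting an $\mathbb E$-triangle $X\to T\to Z\dashrightarrow$ with $X\in\mathcal T^\wedge_n$, $T\in\mathcal T$, let $\mathcal T^\vee_{n+1}$ be the class of $X$ admitting an $\mathbb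 E$-triangle $X\to T\to Z\dashrightarrow$ with $T\in\mathcal T$, $Z\in\mathcal T^\vee_n$, and let $\mathcal T^\wedge=\bigcup_n\mathcal T^\wedge_n$. With $\mathcal I$ the injective objects, $\operatorname{id}\mathcal D\le n$ means $\mathcal D\subseteq\mathcal I^\vee_n$. A *cotorsion pair* $(\mathcal U,\mathcal V)$ is a pair of subcategories with $\mathbb E(\mathcal U,\mathcal V)=0$ such that every object $X$ admits $\mathbb E$-triangles $V_X\to U_X\to X\dashrightarrow$ and $X\to V^X\to U^X\dashrightarrow$ with $U_X,U^X\in\mathcal U$ and $V_X,V^X\in\mathcal V$; it is *hereditary* if $\mathbb E^2(\mathcal U,\mathcal V)=0$. A subcategory $\mathcal T$ is *$n$-cotilting* ($n\ge1$) if $\operatorname{id}\mathcal T\le n$, $\mathbb E^i(\mathcal T,\mathcal T)=0$ for $1\le i\le n$, and every injective object lies in $\mathcal T^\wedge_n$. A hereditary cotorsion pair $(\mathcal U,\mathcal V)$ is *cotilting* if $\mathcal T=\mathcal U\cap\mathcal V$ is $n$-cotilting for some $n\ge1$, $\mathcal V=\mathcal T^\wedge$, and $\mathcal U={}^{\perp}\mathcal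 T=\{X:\mathbb E^i(X,\mathcal T)=0\ \forall i>0\}$. **Theorem.** Let $(\mathcal A,\mathcal B,\mathcal C)$ be a recollement of extriangulated categories such that $\mathcal B$ has enough projectives and enough injectives and $i^!$, $j_!$ are exact. Let $(\mathcal U_1,\mathcal V_1)$ and $(\mathcal U_3,\mathcal V_3)$ be cotilting cotorsion pairs in $\mathcal A$ and $\mathcal C$. Put $$\mathcal V_2=\{X\in\mathcal B : i^!X\in\mathcal V_1,\ j^*X\in\mathcal V_3\},\qquad \mathcal U_2={}^{\perp_1}\mathcal V_2=\{X\in\mathcal B:\mathbb E_{\mathcal B}(X,\mathcal V_2)=0\}.$$ Then $(\mathcal U_2,\mathcal V_2)$ is a cotilting cotorsion pair in $\mathcal B$. Moreover, if $\operatorname{id}_{\mathcal A}\mathcal V_1\le n_1$ and $\operatorname{id}_{\mathcal C}\mathcal V_3\le n_3$, then $\operatorname{id}_{\mathcal B}\mathcal V_2\le\max\{n_1+1,n_3\}$. -/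

import Mathlib

open CategoryTheory CategoryTheory.Limits Opposite

universe w₁ w₂ w₃ w v₁ v₂ v₃ v u₁ u₂ u₃ u

noncomputable section

namespace Extri

attribute [local instance] hasBinaryBiproducts_of_finite_biproducts

/-! ## Extriangulated categories -/

/-- A bifunctor `𝔼 : Cᵒᵖ × C ⥤ Ab`, written in curried form. -/
abbrev Bifunctor (C : Type u) [Category.{v} C] := Cᵒᵖ ⥤ C ⥤ AddCommGrpCat.{w}

namespace Bifunctor

variable {C : Type u} [Category.{v} C] (𝔼 : Bifunctor.{w} C)

/-- The abelian group `𝔼(X, A)` of extensions. -/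
abbrev Ext (X A : C) : Type w := (𝔼.obj (op X)).obj A

/-- `a_* δ`. -/
def push {X A A' : C} (a : A ⟶ A') : 𝔼.Ext X A →+ 𝔼.Ext X A' :=
  ((𝔼.obj (op X)).map a).hom

/-- `c^* δ`. -/
def pull {X X' A : C} (c : X ⟶ X') : 𝔼.Ext X' A →+ 𝔼.Ext X A :=
  ((𝔼.map c.op).app A).hom

/-- The direct sum `δ ⊕ δ'` in `𝔼(X ⊕ X', A ⊕ A')`, i.e. the extension with components
`(δ, 0, 0, δ')`. -/
def directSum [Preadditive C] [HasBinaryBiproducts C] {X X' A A' : C}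
    (δ : 𝔼.Ext X A) (δ' : 𝔼.Ext X' A') : 𝔼.Ext (X ⊞ X') (A ⊞ A') :=
  𝔼.pull (biprod.fst : X ⊞ X' ⟶ X) (𝔼.push (biprod.inl : A ⟶ A ⊞ A') δ) +
    𝔼.pull (biprod.snd : X ⊞ X' ⟶ X') (𝔼.push (biprod.inr : A' ⟶ A ⊞ A') δ')

end Bifunctor

/-- An extriangulated structure (Nakaoka–Palu) on an additive category `C`: an additive
bifunctor `𝔼`, an additive realization `𝔰`, and the axioms (ET3), (ET3)ᵒᵖ, (ET4), (ET4)ᵒᵖ.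
The realization is encoded by the relation `Realizes δ x y`, which says that
`𝔰(δ) = [A --x--> B --y--> X]`. -/
class Extriangulated (C : Type u) [Category.{v} C] [Preadditive C] [HasFiniteBiproducts C] where
  /-- the bifunctor of extensions -/
  𝔼 : Bifunctor.{w} C
  additive_left : 𝔼.Additive
  additive_right : ∀ X : Cᵒᵖ, (𝔼.obj X).Additive
  /-- `𝔰(δ) = [A --x--> B --y--> X]` -/
  Realizes : ∀ {X A B : C}, 𝔼.Ext X A → (A ⟶ B) → (B ⟶ X) → Prop
  /-- `𝔰(δ)` is exactly one equivalence class of sequences `A ⟶ B ⟶ X`; -/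
  exists_realizes : ∀ {X A : C} (δ : 𝔼.Ext X A),
    ∃ (B : C) (x : A ⟶ B) (y : B ⟶ X), Realizes δ x y
  /-- two sequences in it are equivalent, -/
  realizes_unique : ∀ {X A B B' : C} {δ : 𝔼.Ext X A} {x : A ⟶ B} {y : B ⟶ X}
    {x' : A ⟶ B'} {y' : B' ⟶ X}, Realizes δ x y → Realizes δ x' y' →
    ∃ b : B ≅ B', x ≫ b.hom = x' ∧ b.hom ≫ y' = y
  /-- and it contains every sequence equivalent to one of its members. -/
  realizes_of_iso : ∀ {X A B B' : C} {δ : 𝔼.Ext X A} {x : A ⟶ B} {y : B ⟶ X}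
    {x' : A ⟶ B'} {y' : B' ⟶ X} (b : B ≅ B'), Realizes δ x y →
    x ≫ b.hom = x' → b.hom ≫ y' = y → Realizes δ x' y'
  /-- A morphism of extensions is realized by a morphism of sequences. -/
  realizes_map : ∀ {X A B X' A' B' : C} {δ : 𝔼.Ext X A} {x : A ⟶ B} {y : B ⟶ X}
    {δ' : 𝔼.Ext X' A'} {x' : A' ⟶ B'} {y' : B' ⟶ X'},
    Realizes δ x y → Realizes δ' x' y' →
    ∀ (a : A ⟶ A') (c : X ⟶ X'), 𝔼.push a δ = 𝔼.pull c δ' →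
    ∃ b : B ⟶ B', x ≫ b = a ≫ x' ∧ y ≫ c = b ≫ y'
  /-- `𝔰(0) = [A ⟶ A ⊕ X ⟶ X]` -/
  realizes_zero : ∀ X A : C,
    Realizes (0 : 𝔼.Ext X A) (biprod.inl : A ⟶ A ⊞ X) (biprod.snd : A ⊞ X ⟶ X)
  /-- `𝔰(δ ⊕ δ') = 𝔰(δ) ⊕ 𝔰(δ')` -/
  realizes_directSum : ∀ {X A B X' A' B' : C} {δ : 𝔼.Ext X A} {x : A ⟶ B} {y : B ⟶ X}
    {δ' : 𝔼.Ext X' A'} {x' : A' ⟶ B'} {y' : B' ⟶ X'},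
    Realizes δ x y → Realizes δ' x' y' →
    Realizes (𝔼.directSum δ δ') (biprod.map x x') (biprod.map y y')
  /-- (ET3) -/
  et3 : ∀ {X A B X' A' B' : C} {δ : 𝔼.Ext X A} {x : A ⟶ B} {y : B ⟶ X}
    {δ' : 𝔼.Ext X' A'} {x' : A' ⟶ B'} {y' : B' ⟶ X'},
    Realizes δ x y → Realizes δ' x' y' →
    ∀ (a : A ⟶ A') (b : B ⟶ B'), x ≫ b = a ≫ x' →
    ∃ c : X ⟶ X', y ≫ c = b ≫ y' ∧ 𝔼.push a δ = 𝔼.pull c δ'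
  /-- (ET3)ᵒᵖ -/
  et3_op : ∀ {X A B X' A' B' : C} {δ : 𝔼.Ext X A} {x : A ⟶ B} {y : B ⟶ X}
    {δ' : 𝔼.Ext X' A'} {x' : A' ⟶ B'} {y' : B' ⟶ X'},
    Realizes δ x y → Realizes δ' x' y' →
    ∀ (b : B ⟶ B') (c : X ⟶ X'), y ≫ c = b ≫ y' →
    ∃ a : A ⟶ A', x ≫ b = a ≫ x' ∧ 𝔼.push a δ = 𝔼.pull c δ'
  /-- (ET4): for `A --f--> B --f'--> D` realizing `δ` and `B --g--> G --g'--> F`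
  realizing `δ'`. -/
  et4 : ∀ {A B D G F : C} {δ : 𝔼.Ext D A} {f : A ⟶ B} {f' : B ⟶ D}
    {δ' : 𝔼.Ext F B} {g : B ⟶ G} {g' : G ⟶ F},
    Realizes δ f f' → Realizes δ' g g' →
    ∃ (E : C) (h' : G ⟶ E) (d : D ⟶ E) (e : E ⟶ F) (δ'' : 𝔼.Ext E A),
      Realizes δ'' (f ≫ g) h' ∧ g ≫ h' = f' ≫ d ∧ h' ≫ e = g' ∧
      Realizes (𝔼.push f' δ') d e ∧ 𝔼.pull d δ'' = δ ∧ 𝔼.push f δ'' = 𝔼.pull e δ'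
  /-- (ET4)ᵒᵖ: for `D --f'--> A --f--> B` realizing `δ` and `F --g'--> B --g--> G`
  realizing `δ'`. -/
  et4_op : ∀ {A B D G F : C} {δ : 𝔼.Ext B D} {f' : D ⟶ A} {f : A ⟶ B}
    {δ' : 𝔼.Ext G F} {g' : F ⟶ B} {g : B ⟶ G},
    Realizes δ f' f → Realizes δ' g' g →
    ∃ (E : C) (h' : E ⟶ A) (d : D ⟶ E) (e : E ⟶ F) (δ'' : 𝔼.Ext G E),
      Realizes δ'' h' (f ≫ g) ∧ d ≫ h' = f' ∧ h' ≫ f = e ≫ g' ∧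
      Realizes (𝔼.pull g' δ) d e ∧ 𝔼.push e δ'' = δ' ∧ 𝔼.push d δ = 𝔼.pull g δ''

section Basic

variable {C : Type u} [Category.{v} C] [Preadditive C] [HasFiniteBiproducts C]
  [Extriangulated.{w} C]

/-- The group `𝔼(X, A)` in an extriangulated category. -/
abbrev Ext (X A : C) : Type w := (Extriangulated.𝔼 : Bifunctor.{w} C).Ext X A

/-- `A --x--> B --y--> X` is (the underlying sequence of) an `𝔼`-triangle. -/
def IsTriangle {A B X : C} (x : A ⟶ B) (y : B ⟶ X) : Prop :=
  ∃ δ : Ext.{w} X A, Extriangulated.Realizes δ x y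

def IsInflation {A B : C} (x : A ⟶ B) : Prop :=
  ∃ (X : C) (y : B ⟶ X), IsTriangle.{w} x y

def IsDeflation {B X : C} (y : B ⟶ X) : Prop :=
  ∃ (A : C) (x : A ⟶ B), IsTriangle.{w} x y

/-- A morphism is compatible if it is an isomorphism as soon as it is both an inflation and a
deflation. -/
def IsCompatible {A B : C} (f : A ⟶ B) : Prop :=
  IsInflation.{w} f → IsDeflation.{w} f → IsIso f

/-- `A --f--> B --g--> X` is left exact: `A --f--> B --p--> K` is an `𝔼`-triangle and `g = p ≫ q`
for a compatible inflation `q : K ⟶ X`. -/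
def IsLeftExactSeq {A B X : C} (f : A ⟶ B) (g : B ⟶ X) : Prop :=
  ∃ (K : C) (p : B ⟶ K) (q : K ⟶ X),
    IsTriangle.{w} f p ∧ IsInflation.{w} q ∧ IsCompatible.{w} q ∧ p ≫ q = g

/-- `A --f--> B --g--> X` is right exact: `K --q--> B --g--> X` is an `𝔼`-triangle and `f = p ≫ q`
for a compatible deflation `p : A ⟶ K`. -/
def IsRightExactSeq {A B X : C} (f : A ⟶ B) (g : B ⟶ X) : Prop :=
  ∃ (K : C) (p : A ⟶ K) (q : K ⟶ B),
    IsTriangle.{w} q g ∧ IsDeflation.{w} p ∧ IsCompatible.{w} p ∧ p ≫ q = f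

/-- The four-term `𝔼`-triangle sequence `A --f--> B --g--> X --h--> D` is left exact: it is
spliced from `𝔼`-triangles `A --f--> B --p--> K` and `K --q--> X --h--> D` with `q` compatible. -/
def IsLeftExactTriangleSeq {A B X D : C} (f : A ⟶ B) (g : B ⟶ X) (h : X ⟶ D) : Prop :=
  ∃ (K : C) (p : B ⟶ K) (q : K ⟶ X),
    IsTriangle.{w} f p ∧ IsTriangle.{w} q h ∧ p ≫ q = g ∧ IsCompatible.{w} q

/-- The four-term `𝔼`-triangle sequence `A --f--> B --g--> X --h--> D` is right exact: it is
spliced from `𝔼`-triangles `A --f--> B --p--> K` and `K --q--> X --h--> D` with `p` compatible. -/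
def IsRightExactTriangleSeq {A B X D : C} (f : A ⟶ B) (g : B ⟶ X) (h : X ⟶ D) : Prop :=
  ∃ (K : C) (p : B ⟶ K) (q : K ⟶ X),
    IsTriangle.{w} f p ∧ IsTriangle.{w} q h ∧ p ≫ q = g ∧ IsCompatible.{w} p

variable (C) in
/-- Condition (WIC). -/
structure WIC : Prop where
  deflation : ∀ {A B X : C} (f : A ⟶ B) (g : B ⟶ X), IsDeflation.{w} (f ≫ g) → IsDeflation.{w} g
  inflation : ∀ {A B X : C} (f : A ⟶ B) (g : B ⟶ X), IsInflation.{w} (f ≫ g) → IsInflation.{w} f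

/-- The projective objects: morphisms to `X` lift along every deflation onto `X`. -/
def projectives : ObjectProperty C := fun P =>
  ∀ ⦃B X : C⦄ (y : B ⟶ X), IsDeflation.{w} y → ∀ f : P ⟶ X, ∃ g : P ⟶ B, g ≫ y = f

/-- The injective objects: morphisms from `A` extend along every inflation from `A`. -/
def injectives : ObjectProperty C := fun I =>
  ∀ ⦃A B : C⦄ (x : A ⟶ B), IsInflation.{w} x → ∀ f : A ⟶ I, ∃ g : B ⟶ I, x ≫ g = f

variable (C) in
def HasEnoughProjectives : Prop :=
  ∀ X : C, ∃ (P : C) (y : P ⟶ X), projectives.{w} P ∧ IsDeflation.{w} y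

variable (C) in
def HasEnoughInjectives : Prop :=
  ∀ X : C, ∃ (I : C) (x : X ⟶ I), injectives.{w} I ∧ IsInflation.{w} x

end Basic

/-! ## The standing conventions -/

/-- Every object is a finite direct sum of objects with local endomorphism rings. -/
def IsKrullSchmidt (C : Type u) [Category.{v} C] [Preadditive C] [HasFiniteBiproducts C] : Prop :=
  ∀ X : C, ∃ (n : ℕ) (f : Fin n → C), (∀ i, IsLocalRing (End (f i))) ∧ Nonempty (X ≅ ⨁ f)

/-- `C` is a Krull–Schmidt, Hom-finite, `k`-linear extriangulated category satisfying (WIC).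
Here `k`-linearity of the extriangulated structure says that the two actions of `k` on `𝔼(X, A)`,
through `X` and through `A`, agree, i.e. that `𝔼` is a `k`-bilinear bifunctor. -/
structure StandingConventions (k : Type u₁) [Field k] (C : Type u) [Category.{v} C]
    [Preadditive C] [Linear k C] [HasFiniteBiproducts C] [Extriangulated.{w} C] : Prop where
  krullSchmidt : IsKrullSchmidt C
  homFinite : ∀ X Y : C, Module.Finite k (X ⟶ Y)
  linear : ∀ (r : k) {X A : C} (δ : Ext.{w} X A),
    Extriangulated.𝔼.push (r • 𝟙 A) δ = Extriangulated.𝔼.pull (r • 𝟙 X) δ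
  wic : WIC.{w} C

/-! ## Exact functors and recollements -/

section Functors

variable {C : Type u₁} [Category.{v₁} C] [Preadditive C] [HasFiniteBiproducts C]
  [Extriangulated.{w₁} C]
  {D : Type u₂} [Category.{v₂} D] [Preadditive D] [HasFiniteBiproducts D]
  [Extriangulated.{w₂} D]

structure IsLeftExact (F : C ⥤ D) : Prop where
  additive : F.Additive
  compatible : ∀ {X Y : C} (f : X ⟶ Y), IsCompatible.{w₁} f → IsCompatible.{w₂} (F.map f)
  leftExact : ∀ {A B X : C} (f : A ⟶ B) (g : B ⟶ X),
    IsLeftExactSeq.{w₁} f g → IsLeftExactSeq.{w₂} (F.map f) (F.map g)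

structure IsRightExact (F : C ⥤ D) : Prop where
  additive : F.Additive
  compatible : ∀ {X Y : C} (f : X ⟶ Y), IsCompatible.{w₁} f → IsCompatible.{w₂} (F.map f)
  rightExact : ∀ {A B X : C} (f : A ⟶ B) (g : B ⟶ X),
    IsRightExactSeq.{w₁} f g → IsRightExactSeq.{w₂} (F.map f) (F.map g)

/-- Exact functors: they preserve compatible morphisms and `𝔼`-triangles. (Under (WIC) this means
being both left and right exact.) -/
structure IsExact (F : C ⥤ D) : Prop where
  additive : F.Additive
  compatible : ∀ {X Y : C} (f : X ⟶ Y), IsCompatible.{w₁} f → IsCompatible.{w₂} (F.map f)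
  exact : ∀ {A B X : C} (f : A ⟶ B) (g : B ⟶ X),
    IsTriangle.{w₁} f g → IsTriangle.{w₂} (F.map f) (F.map g)

end Functors

/-- A recollement `(A, B, C)` of extriangulated categories. The six functors
`i^*, i_*, i^!, j_!, j^*, j_*` are written `iPull, iPush, iShriek, jShriek, jPull, jPush`. -/
structure Recollement (A : Type u₁) (B : Type u₂) (C : Type u₃)
    [Category.{v₁} A] [Preadditive A] [HasFiniteBiproducts A] [Extriangulated.{w₁} A]
    [Category.{v₂} B] [Preadditive B] [HasFiniteBiproducts B] [Extriangulated.{w₂} B]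
    [Category.{v₃} C] [Preadditive C] [HasFiniteBiproducts C] [Extriangulated.{w₃} C] where
  iPull : B ⥤ A
  iPush : A ⥤ B
  iShriek : B ⥤ A
  jShriek : C ⥤ B
  jPull : B ⥤ C
  jPush : C ⥤ B
  iPush_exact : IsExact.{w₁, w₂} iPush
  jPull_exact : IsExact.{w₂, w₃} jPull
  iPull_rightExact : IsRightExact.{w₂, w₁} iPull
  jShriek_rightExact : IsRightExact.{w₃, w₂} jShriek
  iShriek_leftExact : IsLeftExact.{w₂, w₁} iShriek
  jPush_leftExact : IsLeftExact.{w₃, w₂} jPush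
  /-- (R1) -/
  iPullAdj : iPull ⊣ iPush
  iShriekAdj : iPush ⊣ iShriek
  jShriekAdj : jShriek ⊣ jPull
  jPushAdj : jPull ⊣ jPush
  /-- (R2): the essential image of `i_*` is the kernel of `j^*`. -/
  essImage_iff : ∀ X : B, iPush.essImage X ↔ IsZero (jPull.obj X)
  /-- (R3) -/
  iPush_full : iPush.Full
  iPush_faithful : iPush.Faithful
  jShriek_full : jShriek.Full
  jShriek_faithful : jShriek.Faithful
  jPush_full : jPush.Full
  jPush_faithful : jPush.Faithful
  /-- (R4): the left exact sequence `i_* i^! X ⟶ X ⟶ j_* j^* X ⟶ i_* Y`. -/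
  exists_left : ∀ X : B, ∃ (Y : A) (h : jPush.obj (jPull.obj X) ⟶ iPush.obj Y),
    IsLeftExactTriangleSeq.{w₂} (iShriekAdj.counit.app X) (jPushAdj.unit.app X) h
  /-- (R5): the right exact sequence `i_* Y ⟶ j_! j^* X ⟶ X ⟶ i_* i^* X`. -/
  exists_right : ∀ X : B, ∃ (Y : A) (f : iPush.obj Y ⟶ jShriek.obj (jPull.obj X)),
    IsRightExactTriangleSeq.{w₂} f (jShriekAdj.counit.app X) (iPullAdj.unit.app X)

/-! ## Cotorsion pairs and cotilting subcategories -/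

section Cotorsion

variable {C : Type u} [Category.{v} C] [Preadditive C] [HasFiniteBiproducts C]
  [Extriangulated.{w} C]

/-- The convention on subcategories: full subcategories closed under isomorphisms, finite direct
sums and direct summands. -/
structure IsSubcategory (U : ObjectProperty C) : Prop where
  zero : ∀ X : C, IsZero X → U X
  iso : ∀ {X Y : C}, (X ≅ Y) → U X → U Y
  sum : ∀ X Y : C, U X → U Y → U (X ⊞ Y)
  summand : ∀ X Y : C, U (X ⊞ Y) → U X

/-- `CoCone(U, V)`: objects `X` with an `𝔼`-triangle `X ⟶ Y ⟶ Z`, `Y ∈ U`, `Z ∈ V`. -/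
def CoCone (U V : ObjectProperty C) : ObjectProperty C := fun X =>
  ∃ (Y Z : C) (x : X ⟶ Y) (y : Y ⟶ Z), U Y ∧ V Z ∧ IsTriangle.{w} x y

/-- `Cone(U, V)`: objects `Z` with an `𝔼`-triangle `X ⟶ Y ⟶ Z`, `X ∈ U`, `Y ∈ V`. -/
def Cone (U V : ObjectProperty C) : ObjectProperty C := fun Z =>
  ∃ (X Y : C) (x : X ⟶ Y) (y : Y ⟶ Z), U X ∧ V Y ∧ IsTriangle.{w} x y

/-- `U^∧_n`, with `U^∧_0 = U` and `U^∧_{n+1} = Cone(U^∧_n, U)`. -/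
def wedge (U : ObjectProperty C) : ℕ → ObjectProperty C
  | 0 => U
  | n + 1 => Cone.{w} (wedge U n) U

/-- `U^∨_n`, with `U^∨_0 = U` and `U^∨_{n+1} = CoCone(U, U^∨_n)`. -/
def vee (U : ObjectProperty C) : ℕ → ObjectProperty C
  | 0 => U
  | n + 1 => CoCone.{w} U (vee U n)

/-- `U^∧`, the union of all `U^∧_n`. -/
def wedgeUnion (U : ObjectProperty C) : ObjectProperty C := fun X => ∃ n, wedge.{w} U n X

/-- `IsSyzygy n X Z` says that `Z` is an `n`-th syzygy `Ωⁿ X` of `X`. -/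
def IsSyzygy : ℕ → C → C → Prop
  | 0, X, Z => Nonempty (Z ≅ X)
  | n + 1, X, Z => ∃ W, IsSyzygy n X W ∧
      ∃ (P : C) (x : Z ⟶ P) (y : P ⟶ W), projectives.{w} P ∧ IsTriangle.{w} x y

/-- `𝔼^{n+1}(X, Y) = 𝔼(Ωⁿ X, Y)` vanishes. When there are enough projectives `Ωⁿ X` exists, and
`𝔼(Ωⁿ X, Y)` does not depend on its choice. -/
def ExtSuccVanishes (n : ℕ) (X Y : C) : Prop :=
  ∀ Z : C, IsSyzygy.{w} n X Z → ∀ δ : Ext.{w} Z Y, δ = 0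

/-- `^{⊥₁} V`, the objects `X` with `𝔼(X, V) = 0`. -/
def leftPerpOne (V : ObjectProperty C) : ObjectProperty C := fun X =>
  ∀ Y, V Y → ∀ δ : Ext.{w} X Y, δ = 0

/-- `^⊥ V`, the objects `X` with `𝔼^i(X, V) = 0` for all `i > 0`. -/
def leftPerp (V : ObjectProperty C) : ObjectProperty C := fun X =>
  ∀ Y, V Y → ∀ n : ℕ, ExtSuccVanishes.{w} n X Y

/-- `id U ≤ n`. -/
def InjDimLE (U : ObjectProperty C) (n : ℕ) : Prop := U ≤ vee.{w} injectives.{w} n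

structure IsCotorsionPair (U V : ObjectProperty C) : Prop where
  left : IsSubcategory U
  right : IsSubcategory V
  ext_zero : ∀ X Y, U X → V Y → ∀ δ : Ext.{w} X Y, δ = 0
  /-- `V_X ⟶ U_X ⟶ X` -/
  exists_left : ∀ X : C, Cone.{w} V U X
  /-- `X ⟶ V^X ⟶ U^X` -/
  exists_right : ∀ X : C, CoCone.{w} V U X

/-- A cotorsion pair `(U, V)` with `𝔼²(U, V) = 0`. -/
structure IsHereditaryCotorsionPair (U V : ObjectProperty C) : Prop
    extends IsCotorsionPair.{w} U V where
  ext_two_zero : ∀ X Y, U X → V Y → ExtSuccVanishes.{w} 1 X Y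

/-- `T` is an `n`-cotilting subcategory. -/
structure IsNCotilting (n : ℕ) (T : ObjectProperty C) : Prop where
  subcategory : IsSubcategory T
  injDim_le : InjDimLE.{w} T n
  /-- `𝔼^i(T, T) = 0` for `i = 1, …, n` -/
  ext_zero : ∀ i < n, ∀ X Y, T X → T Y → ExtSuccVanishes.{w} i X Y
  /-- Every injective `I` admits `𝔼`-triangles `R₁ ⟶ T₀ ⟶ I`, `R₂ ⟶ T₁ ⟶ R₁`, …,
  `Tₙ ⟶ Tₙ₋₁ ⟶ Rₙ₋₁` with all `Tᵢ ∈ T`. -/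
  injective_mem : ∀ I, injectives.{w} I → wedge.{w} T n I

/-- A cotilting cotorsion pair `(U, V)`: with `T = U ∩ V`, it is hereditary, `T` is `n`-cotilting
for some `n ≥ 1`, `V = T^∧` and `U = ^⊥ T`. -/
structure IsCotiltingCotorsionPair (U V : ObjectProperty C) : Prop
    extends IsHereditaryCotorsionPair.{w} U V where
  cotilting : ∃ n, 1 ≤ n ∧ IsNCotilting.{w} n (U ⊓ V)
  right_eq : V = wedgeUnion.{w} (U ⊓ V)
  left_eq : U = leftPerp.{w} (U ⊓ V)

end Cotorsion

/-! ## The glued pair -/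

section Glue

variable {A : Type u₁} {B : Type u₂} {C : Type u₃}
    [Category.{v₁} A] [Preadditive A] [HasFiniteBiproducts A] [Extriangulated.{w₁} A]
    [Category.{v₂} B] [Preadditive B] [HasFiniteBiproducts B] [Extriangulated.{w₂} B]
    [Category.{v₃} C] [Preadditive C] [HasFiniteBiproducts C] [Extriangulated.{w₃} C]

/-- `V₂ = {X | i^! X ∈ V₁ and j^* X ∈ V₃}`. -/
def Recollement.gluedRight (R : Recollement.{w₁, w₂, w₃} A B C)
    (V₁ : ObjectProperty A) (V₃ : ObjectProperty C) : ObjectProperty B := fun X =>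
  V₁ (R.iShriek.obj X) ∧ V₃ (R.jPull.obj X)

/-- `U₂ = ^{⊥₁} V₂`. -/
def Recollement.gluedLeft (R : Recollement.{w₁, w₂, w₃} A B C)
    (V₁ : ObjectProperty A) (V₃ : ObjectProperty C) : ObjectProperty B :=
  leftPerpOne.{w₂} (R.gluedRight V₁ V₃)

end Glue

end Extri

end

namespace Extri

open scoped ZeroObject

attribute [local instance] hasBinaryBiproducts_of_finite_biproducts

/-! Write `V₂` and `U₂` for the glued classes. Three independent facts combine.

A cotorsion pair whose right class is closed under cones and has finite injective dimension is
automatically cotilting (`IsCotorsionPair.isCotilting`): dimension shifting kills all higher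
extensions from the left to the right class, and iterated left approximations resolve each object of
the right class by the intersection in finitely many steps. Conversely, the right class of a
cotilting pair has both properties. Since `i^!` and `j^*` are exact, closure under cones passes to
`V₂`.

The glued pair is a cotorsion pair (`isCotorsionPair_glued`). Given `X`, push out along counits to
correct `j^* X` by a term `j_! U` and then `i^!` by a term `i_* U'`; as `j^* i_* = 0`, the second
correction preserves the first. Adjunction puts both terms in `U₂`. Salce's trick on a projective
presentation gives the other approximation.

The injective dimension of `V₂` is finite (`injDimLE_gluedRight`). Exactness of `i^!` turns (R4)
into a triangle `i_* i^! X ⟶ X ⟶ j_* j^* X`. The functor `j_*` does not raise injective dimension,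
because it preserves deflations (`jPush_deflation`); `i_*` raises it by at most one, because (R5)
reaches an arbitrary object from images of `i_*` and `j_!` through two triangles. -/

theorem isIso_of_sub_id_sq_eq_zero {C : Type u} [Category.{v} C] [Preadditive C]
    {X : C} {e : X ⟶ X} (he : (e - 𝟙 X) ≫ (e - 𝟙 X) = 0) : IsIso e := by
  have h1 : e ≫ (𝟙 X - (e - 𝟙 X)) = 𝟙 X - (e - 𝟙 X) ≫ (e - 𝟙 X) := by
    simp only [Preadditive.comp_sub, Preadditive.sub_comp, Category.comp_id, Category.id_comp]
    abel
  have h2 : (𝟙 X - (e - 𝟙 X)) ≫ e = 𝟙 X - (e - 𝟙 X) ≫ (e - 𝟙 X) := by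
    simp only [Preadditive.comp_sub, Preadditive.sub_comp, Category.comp_id, Category.id_comp]
    abel
  exact ⟨𝟙 X - (e - 𝟙 X), by rw [h1, he, sub_zero], by rw [h2, he, sub_zero]⟩

/-! ### Exact sequences of Hom and `𝔼` attached to a triangle -/

section Triangles

variable {C : Type u} [Category.{v} C] [Preadditive C] [HasFiniteBiproducts C]
  [Extriangulated.{w} C]

theorem push_id {X A : C} (δ : Ext.{w} X A) : Extriangulated.𝔼.push (𝟙 A) δ = δ := by
  simp [Bifunctor.push]

theorem pull_id {X A : C} (δ : Ext.{w} X A) : Extriangulated.𝔼.pull (𝟙 X) δ = δ := by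
  simp [Bifunctor.pull]

theorem push_comp {X A A' A'' : C} (a : A ⟶ A') (a' : A' ⟶ A'') (δ : Ext.{w} X A) :
    Extriangulated.𝔼.push (a ≫ a') δ = Extriangulated.𝔼.push a' (Extriangulated.𝔼.push a δ) := by
  simp [Bifunctor.push]

theorem pull_comp {X X' X'' A : C} (c : X ⟶ X') (c' : X' ⟶ X'') (δ : Ext.{w} X'' A) :
    Extriangulated.𝔼.pull (c ≫ c') δ = Extriangulated.𝔼.pull c (Extriangulated.𝔼.pull c' δ) := by
  simp [Bifunctor.pull]

theorem push_pull {X X' A A' : C} (a : A ⟶ A') (c : X ⟶ X') (δ : Ext.{w} X' A) :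
    Extriangulated.𝔼.push a (Extriangulated.𝔼.pull c δ) =
      Extriangulated.𝔼.pull c (Extriangulated.𝔼.push a δ) := by
  have h := (Extriangulated.𝔼.map c.op).naturality a
  exact (congrArg (fun f => f.hom δ) h).symm

theorem pull_sub {X X' A : C} (c c' : X ⟶ X') (δ : Ext.{w} X' A) :
    Extriangulated.𝔼.pull (c - c') δ =
      Extriangulated.𝔼.pull c δ - Extriangulated.𝔼.pull c' δ := by
  have := Extriangulated.additive_left (C := C)
  simp only [Bifunctor.pull, op_sub, Functor.map_sub]
  rfl

theorem pull_zero {X X' A : C} (δ : Ext.{w} X' A) :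
    Extriangulated.𝔼.pull (0 : X ⟶ X') δ = 0 := by
  simpa using pull_sub (0 : X ⟶ X') 0 δ

variable {A B X : C} {δ : Ext.{w} X A} {x : A ⟶ B} {y : B ⟶ X}

open Extriangulated

theorem push_eq_zero (h : Realizes δ x y) : 𝔼.push x δ = 0 := by
  obtain ⟨c, -, hc⟩ := et3 h (realizes_zero X B) x biprod.inl rfl
  simpa using hc

theorem pull_eq_zero (h : Realizes δ x y) : 𝔼.pull y δ = 0 := by
  obtain ⟨a, -, ha⟩ := et3_op (realizes_zero B A) h biprod.snd y rfl
  simpa using ha.symm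

theorem exists_extend (h : Realizes δ x y) {W : C} (f : A ⟶ W) (hf : 𝔼.push f δ = 0) :
    ∃ g : B ⟶ W, x ≫ g = f := by
  obtain ⟨b, hb, -⟩ := realizes_map h (realizes_zero X W) f (𝟙 X) (by simp [hf])
  exact ⟨b ≫ biprod.fst, by simp [reassoc_of% hb]⟩

theorem exists_lift (h : Realizes δ x y) {W : C} (f : W ⟶ X) (hf : 𝔼.pull f δ = 0) :
    ∃ g : W ⟶ B, g ≫ y = f := by
  obtain ⟨b, -, hb⟩ := realizes_map (realizes_zero W A) h (𝟙 A) f (by simp [hf])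
  exact ⟨biprod.inr ≫ b, by simp [← hb]⟩

theorem exists_factor (h : Realizes δ x y) {W : C} (f : W ⟶ B) (hf : f ≫ y = 0) :
    ∃ g : W ⟶ A, g ≫ x = f := by
  obtain ⟨a, ha, -⟩ := et3_op (realizes_zero X W) h (biprod.fst ≫ f) 0 (by simp [hf])
  exact ⟨a, by simpa using ha.symm⟩

theorem exists_push_eq (h : Realizes δ x y) {W : C} (ε : Ext.{w} X W) (hε : 𝔼.pull y ε = 0) :
    ∃ f : A ⟶ W, 𝔼.push f δ = ε := by
  obtain ⟨Z, x', y', h'⟩ := exists_realizes ε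
  obtain ⟨b, hb⟩ := exists_lift h' y hε
  obtain ⟨a, -, ha⟩ := et3_op h h' b (𝟙 X) (by simp [hb])
  exact ⟨a, by rw [ha, pull_id]⟩

theorem exists_pull_eq (h : Realizes δ x y) {W : C} (ε : Ext.{w} W A) (hε : 𝔼.push x ε = 0) :
    ∃ f : W ⟶ X, 𝔼.pull f δ = ε := by
  obtain ⟨Z, x', y', h'⟩ := exists_realizes ε
  obtain ⟨b, hb⟩ := exists_extend h' x hε
  obtain ⟨c, -, hc⟩ := et3 h' h (𝟙 A) b (by simp [hb])
  exact ⟨c, by rw [← hc, push_id]⟩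

/-- Applying (ET4)ᵒᵖ to `ε` and the given triangle produces a triangle `W ⟶ E ⟶ A` realizing the
restriction of `ε`. That restriction vanishes, so `W` is a retract of `E`, and the retraction
carries the extension of `X` by `E` to the required one. -/
theorem exists_pull_eq_middle (h : Realizes δ x y) {W : C} (ε : Ext.{w} B W)
    (hε : 𝔼.pull x ε = 0) : ∃ ε' : Ext.{w} X W, 𝔼.pull y ε' = ε := by
  obtain ⟨Z, x', y', h'⟩ := exists_realizes ε
  obtain ⟨E, h'', d, e, δ'', -, -, -, hde, -, hp⟩ := et4_op h' h
  obtain ⟨r, hr⟩ := exists_extend hde (𝟙 W) (by rw [push_id, hε])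
  exact ⟨𝔼.push r δ'', by rw [← push_pull, ← hp, ← push_comp, hr, push_id]⟩

theorem exists_push_eq_middle (h : Realizes δ x y) {W : C} (ε : Ext.{w} W B)
    (hε : 𝔼.push y ε = 0) : ∃ ε' : Ext.{w} W A, 𝔼.push x ε' = ε := by
  obtain ⟨Z, x', y', h'⟩ := exists_realizes ε
  obtain ⟨E, h'', d, e, δ'', -, -, -, hde, -, hp⟩ := et4 h h'
  obtain ⟨s, hs⟩ := exists_lift hde (𝟙 W) (by rw [pull_id, hε])
  exact ⟨𝔼.pull s δ'', by rw [push_pull, hp, ← pull_comp, hs, pull_id]⟩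

/-- An endomorphism of a triangle that is the identity on the first two terms is an
isomorphism. -/
theorem isIso_of_endomorphism (h : Realizes δ x y) {e : X ⟶ X} (h₁ : y ≫ e = y)
    (h₂ : 𝔼.pull e δ = δ) : IsIso e := by
  obtain ⟨s, hs⟩ := exists_lift h (e - 𝟙 X) (by rw [pull_sub, pull_id, h₂, sub_self])
  apply isIso_of_sub_id_sq_eq_zero
  nth_rewrite 1 [← hs]
  rw [Category.assoc, Preadditive.comp_sub, h₁, Category.comp_id, sub_self, comp_zero]

/-- The cone of an inflation is unique up to isomorphism. -/
theorem cone_iso {A' B' X' : C} {x' : A' ⟶ B'} {y' : B' ⟶ X'} (h : IsTriangle.{w} x y)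
    (h' : IsTriangle.{w} x' y') (a : A ≅ A') (b : B ≅ B') (hab : x ≫ b.hom = a.hom ≫ x') :
    Nonempty (X ≅ X') := by
  obtain ⟨δ, h⟩ := h
  obtain ⟨δ', h'⟩ := h'
  obtain ⟨c, h1, h2⟩ := et3 h h' a.hom b.hom hab
  obtain ⟨c', h3, h4⟩ := et3 h' h a.inv b.inv
    (by rw [Iso.comp_inv_eq, Category.assoc, hab, Iso.inv_hom_id_assoc])
  -- The fillers from (ET3) need not be mutually inverse, but each composite differs from the
  -- identity by a square-zero map.
  have e1 : IsIso (c ≫ c') := isIso_of_endomorphism h (by simp [reassoc_of% h1, h3])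
    (by rw [pull_comp, ← h4, ← push_pull, ← h2, ← push_comp, a.hom_inv_id, push_id])
  have e2 : IsIso (c' ≫ c) := isIso_of_endomorphism h' (by simp [reassoc_of% h3, h1])
    (by rw [pull_comp, ← h2, ← push_pull, ← h4, ← push_comp, a.inv_hom_id, push_id])
  have : IsSplitMono c := ⟨⟨⟨c' ≫ inv (c ≫ c'), by rw [← Category.assoc, IsIso.hom_inv_id]⟩⟩⟩
  have : IsSplitEpi c := ⟨⟨⟨inv (c' ≫ c) ≫ c', by rw [Category.assoc, IsIso.inv_hom_id]⟩⟩⟩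
  have : IsIso c := isIso_of_epi_of_isSplitMono c
  exact ⟨asIso c⟩

end Triangles

/-! ### Inflations, deflations and push-outs -/

section Conflations

variable {C : Type u} [Category.{v} C] [Preadditive C] [HasFiniteBiproducts C]
  [Extriangulated.{w} C] {A B X : C} {x : A ⟶ B} {y : B ⟶ X}

open Extriangulated

theorem isTriangle_biprod (A X : C) :
    IsTriangle.{w} (biprod.inl : A ⟶ A ⊞ X) (biprod.snd : A ⊞ X ⟶ X) :=
  ⟨0, realizes_zero X A⟩

theorem IsTriangle.of_iso {B' : C} {x' : A ⟶ B'} {y' : B' ⟶ X} (h : IsTriangle.{w} x y)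
    (b : B ≅ B') (h₁ : x ≫ b.hom = x') (h₂ : b.hom ≫ y' = y) : IsTriangle.{w} x' y' := by
  obtain ⟨δ, h⟩ := h
  exact ⟨δ, realizes_of_iso b h h₁ h₂⟩

theorem isIso_of_middle_endomorphism (h : IsTriangle.{w} x y) {e : B ⟶ B} (h₁ : x ≫ e = x)
    (h₂ : e ≫ y = y) : IsIso e := by
  obtain ⟨δ, h⟩ := h
  obtain ⟨s, hs⟩ := exists_factor h (e - 𝟙 B) (by
    rw [Preadditive.sub_comp, h₂, Category.id_comp, sub_self])
  apply isIso_of_sub_id_sq_eq_zero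
  nth_rewrite 1 [← hs]
  rw [Category.assoc, Preadditive.comp_sub, h₁, Category.comp_id, sub_self, comp_zero]

/-- The new triangle realizes the extension transported along `c.inv`; its middle term is compared
with `B` by lifting `c` and its inverse to maps of sequences. -/
theorem IsTriangle.comp_iso {X' : C} (h : IsTriangle.{w} x y) (c : X ≅ X') :
    IsTriangle.{w} x (y ≫ c.hom) := by
  obtain ⟨δ, h⟩ := h
  obtain ⟨B', x', y', h'⟩ := exists_realizes (𝔼.pull c.inv δ)
  obtain ⟨b, hb, hb'⟩ := realizes_map h h' (𝟙 A) c.hom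
    (by rw [push_id, ← pull_comp, c.hom_inv_id, pull_id])
  obtain ⟨d, hd, hd'⟩ := realizes_map h' h (𝟙 A) c.inv (by rw [push_id])
  rw [Category.id_comp] at hb hd
  have e1 : IsIso (b ≫ d) := isIso_of_middle_endomorphism ⟨δ, h⟩ (by rw [reassoc_of% hb, hd])
    (by rw [Category.assoc, ← hd', ← reassoc_of% hb', c.hom_inv_id, Category.comp_id])
  have e2 : IsIso (d ≫ b) := isIso_of_middle_endomorphism ⟨_, h'⟩ (by rw [reassoc_of% hd, hb])
    (by rw [Category.assoc, ← hb', ← reassoc_of% hd', c.inv_hom_id, Category.comp_id])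
  have : IsIso b := by
    have : IsSplitMono b := ⟨⟨⟨d ≫ inv (b ≫ d), by rw [← Category.assoc, IsIso.hom_inv_id]⟩⟩⟩
    have : IsSplitEpi b := ⟨⟨⟨inv (d ≫ b) ≫ d, by rw [Category.assoc, IsIso.inv_hom_id]⟩⟩⟩
    exact isIso_of_epi_of_isSplitMono b
  exact ⟨_, realizes_of_iso (asIso b).symm h' (by simp [← hb]) (by simp [hb'])⟩

theorem isTriangle_of_isIso_of_isZero (f : A ⟶ B) [IsIso f] {Z : C} (hZ : IsZero Z)
    (g : B ⟶ Z) : IsTriangle.{w} f g := by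
  refine (isTriangle_biprod A Z).of_iso (?_ : A ⊞ Z ≅ B) ?_ (hZ.eq_of_tgt _ _)
  · exact ⟨biprod.desc f 0, inv f ≫ biprod.inl, by
      ext
      · simp
      · simp
      · exact hZ.eq_of_src _ _
      · exact hZ.eq_of_src _ _, by simp⟩
  · simp

theorem isTriangle_of_isZero_of_isIso {Z : C} (hZ : IsZero Z) (g : Z ⟶ B) (f : B ⟶ X)
    [IsIso f] : IsTriangle.{w} g f := by
  refine (isTriangle_biprod Z X).of_iso (?_ : Z ⊞ X ≅ B) (hZ.eq_of_src _ _) ?_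
  · exact ⟨biprod.snd ≫ inv f, f ≫ biprod.inr, by
      ext
      · exact hZ.eq_of_src _ _
      · exact hZ.eq_of_src _ _
      · exact hZ.eq_of_tgt _ _
      · simp, by simp⟩
  · simp

theorem isInflation_of_isIso (f : A ⟶ B) [IsIso f] : IsInflation.{w} f :=
  ⟨_, 0, isTriangle_of_isIso_of_isZero f (isZero_zero C) 0⟩

theorem isDeflation_of_isIso (f : A ⟶ B) [IsIso f] : IsDeflation.{w} f :=
  ⟨_, 0, isTriangle_of_isZero_of_isIso (isZero_zero C) 0 f⟩

theorem IsInflation.comp {f : A ⟶ B} {g : B ⟶ X} (hf : IsInflation.{w} f)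
    (hg : IsInflation.{w} g) : IsInflation.{w} (f ≫ g) := by
  obtain ⟨D, f', δ, h⟩ := hf
  obtain ⟨F, g', δ', h'⟩ := hg
  obtain ⟨E, k, -, -, δ'', h'', -⟩ := et4 h h'
  exact ⟨E, k, δ'', h''⟩

theorem IsDeflation.comp {f : A ⟶ B} {g : B ⟶ X} (hf : IsDeflation.{w} f)
    (hg : IsDeflation.{w} g) : IsDeflation.{w} (f ≫ g) := by
  obtain ⟨D, f', δ, h⟩ := hf
  obtain ⟨F, g', δ', h'⟩ := hg
  obtain ⟨E, k, -, -, δ'', h'', -⟩ := et4_op h h'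
  exact ⟨E, k, δ'', h''⟩

/-- The cones of two composable inflations and of their composite form a triangle. -/
theorem exists_cone_comp {D F G : C} {f' : B ⟶ D} {g : B ⟶ G} {g' : G ⟶ F}
    (h : IsTriangle.{w} x f') (h' : IsTriangle.{w} g g') :
    ∃ (E : C) (k : G ⟶ E) (d : D ⟶ E) (e : E ⟶ F),
      IsTriangle.{w} (x ≫ g) k ∧ IsTriangle.{w} d e := by
  obtain ⟨δ, h⟩ := h
  obtain ⟨δ', h'⟩ := h'
  obtain ⟨E, k, d, e, δ'', h1, -, -, h2, -⟩ := et4 h h'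
  exact ⟨E, k, d, e, ⟨_, h1⟩, ⟨_, h2⟩⟩

theorem IsTriangle.isZero_of_isIso [IsIso x] (h : IsTriangle.{w} x y) : IsZero X := by
  obtain ⟨e⟩ := cone_iso h (isTriangle_of_isIso_of_isZero (𝟙 B) (isZero_zero C) 0)
    (asIso x) (Iso.refl B) (by simp)
  exact (isZero_zero C).of_iso e

theorem IsTriangle.isIso_of_isZero (h : IsTriangle.{w} x y) (hX : IsZero X) : IsIso x := by
  obtain ⟨δ, h⟩ := h
  have hδ : δ = 0 := by rw [← pull_id δ, hX.eq_of_src (𝟙 X) 0, pull_zero]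
  obtain ⟨r, hr⟩ := exists_extend h (𝟙 A) (by rw [hδ, map_zero])
  obtain ⟨s, hs⟩ := exists_factor h (𝟙 B) (hX.eq_of_tgt _ _)
  have : IsSplitMono x := ⟨⟨⟨r, hr⟩⟩⟩
  have : IsSplitEpi x := ⟨⟨⟨s, hs⟩⟩⟩
  exact isIso_of_epi_of_isSplitMono x

/-- If one component of an inflation into a direct sum is invertible, then the cone is the other
summand. -/
theorem IsTriangle.iso_of_isIso_snd {V A' Y : C} {s : A ⟶ V} {a : A ⟶ A'} [IsIso a]
    {g : V ⊞ A' ⟶ Y} (h : IsTriangle.{w} (biprod.lift s a) g) : Nonempty (V ≅ Y) := by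
  refine cone_iso (isTriangle_biprod A V) h (Iso.refl A)
    ⟨biprod.desc (biprod.lift s a) biprod.inl,
      biprod.lift (biprod.snd ≫ inv a) (biprod.fst - biprod.snd ≫ inv a ≫ s), ?_, ?_⟩ (by simp)
  · ext <;> simp [Preadditive.comp_sub]
  · ext <;> simp [Preadditive.sub_comp, Preadditive.comp_sub]

/-- The push-out of a triangle along a morphism from its first term. -/
theorem IsTriangle.exists_pushout (h : IsTriangle.{w} x y) {A' : C} (a : A ⟶ A') :
    ∃ (E : C) (g : B ⊞ A' ⟶ E) (i : A' ⟶ E) (p : E ⟶ X),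
      IsTriangle.{w} (biprod.lift x a) g ∧ IsTriangle.{w} i p := by
  obtain ⟨δ, h⟩ := h
  -- The inflation `(x, a)` factors as `(1, a)` followed by `x ⊕ 1`, with cones `A'` and `X`; (ET4)
  -- then makes the cone of `(x, a)` an extension of `X` by `A'`.
  have h1 : IsTriangle.{w} (biprod.lift (𝟙 A) a) (biprod.desc (-a) (𝟙 A')) := by
    refine (isTriangle_biprod A A').of_iso
      ⟨biprod.desc (biprod.lift (𝟙 A) a) biprod.inr,
        biprod.desc (biprod.lift (𝟙 A) (-a)) biprod.inr, ?_, ?_⟩ ?_ ?_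
    · ext <;> simp
    · ext <;> simp
    · simp
    · ext <;> simp
  have h2 : IsTriangle.{w} (biprod.map x (𝟙 A')) (biprod.desc y (0 : A' ⟶ X)) := by
    obtain ⟨δ', h'⟩ := isTriangle_of_isIso_of_isZero (𝟙 A') (isZero_zero C) (0 : A' ⟶ 0)
    have h3 : IsTriangle.{w} _ _ := ⟨_, realizes_directSum h h'⟩
    convert h3.comp_iso (⟨biprod.fst, biprod.inl,
      by ext; simp, by simp⟩ : X ⊞ (0 : C) ≅ X) using 1
    ext <;> simp
  obtain ⟨E, k, d, e, h3, h4⟩ := exists_cone_comp h1 h2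
  exact ⟨E, k, d, e, by convert h3 using 1; ext <;> simp, h4⟩

/-- Salce's trick: the push-out of two triangles starting in the same object. -/
theorem IsTriangle.exists_pushout_square (h : IsTriangle.{w} x y) {V U : C} {v : A ⟶ V}
    {u : V ⟶ U} (h' : IsTriangle.{w} v u) :
    ∃ (E E' : C) (i : V ⟶ E) (p : E ⟶ X) (i' : B ⟶ E') (p' : E' ⟶ U),
      IsTriangle.{w} i p ∧ IsTriangle.{w} i' p' ∧ Nonempty (E ≅ E') := by
  obtain ⟨E, g, i, p, h1, h2⟩ := h.exists_pushout v
  obtain ⟨E', g', i', p', h3, h4⟩ := h'.exists_pushout x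
  exact ⟨E, E', i, p, i', p', h2, h4, cone_iso h1 h3 (Iso.refl A) (biprod.braiding B V)
    (by ext <;> simp)⟩

end Conflations

/-! ### Higher extensions and dimension shifting in both variables -/

section ExtVanishes

variable {C : Type u} [Category.{v} C] [Preadditive C] [HasFiniteBiproducts C]
  [Extriangulated.{w} C]

open Extriangulated

/-- The vanishing of `𝔼ⁿ⁺¹(X, Y)`, defined by dimension shifting. -/
def ExtVanishes : ℕ → C → C → Prop
  | 0, X, Y => ∀ δ : Ext.{w} X Y, δ = 0
  | n + 1, X, Y => ∀ ⦃K P : C⦄ (x : K ⟶ P) (y : P ⟶ X), projectives.{w} P →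
      IsTriangle.{w} x y → ExtVanishes n K Y

theorem HasEnoughProjectives.exists_triangle (hP : HasEnoughProjectives.{w} C) (X : C) :
    ∃ (K P : C) (x : K ⟶ P) (y : P ⟶ X), projectives.{w} P ∧ IsTriangle.{w} x y := by
  obtain ⟨P, y, h, K, x, h'⟩ := hP X
  exact ⟨K, P, x, y, h, h'⟩

theorem HasEnoughInjectives.exists_triangle (hI : HasEnoughInjectives.{w} C) (Y : C) :
    ∃ (I Z : C) (x : Y ⟶ I) (y : I ⟶ Z), injectives.{w} I ∧ IsTriangle.{w} x y := by
  obtain ⟨I, x, h, Z, y, h'⟩ := hI Y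
  exact ⟨I, Z, x, y, h, h'⟩

theorem ext_eq_zero_of_projective {P Y : C} (hP : projectives.{w} P) (δ : Ext.{w} P Y) :
    δ = 0 := by
  obtain ⟨Z, x, y, h⟩ := exists_realizes δ
  obtain ⟨s, hs⟩ := hP y ⟨Y, x, δ, h⟩ (𝟙 P)
  rw [← pull_id δ, ← hs, pull_comp, pull_eq_zero h, map_zero]

theorem ext_eq_zero_of_injective {X I : C} (hI : injectives.{w} I) (δ : Ext.{w} X I) :
    δ = 0 := by
  obtain ⟨Z, x, y, h⟩ := exists_realizes δ
  obtain ⟨s, hs⟩ := hI x ⟨X, y, δ, h⟩ (𝟙 I)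
  rw [← push_id δ, ← hs, push_comp, push_eq_zero h, map_zero]

theorem ExtVanishes.of_injective {I : C} (hI : injectives.{w} I) (n : ℕ) (X : C) :
    ExtVanishes.{w} n X I := by
  induction n generalizing X with
  | zero => exact ext_eq_zero_of_injective hI
  | succ n ih => exact fun K _ _ _ _ _ => ih K

theorem ExtVanishes.of_isZero_right {Y : C} (hY : IsZero Y) (n : ℕ) (X : C) :
    ExtVanishes.{w} n X Y :=
  .of_injective (fun _ _ _ _ _ => ⟨0, hY.eq_of_tgt _ _⟩) n X

variable {Y' Y Y'' : C} {f : Y' ⟶ Y} {g : Y ⟶ Y''}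

theorem ExtVanishes.right₂ {n : ℕ} {X : C} (h : IsTriangle.{w} f g)
    (h₁ : ExtVanishes.{w} n X Y') (h₃ : ExtVanishes.{w} n X Y'') : ExtVanishes.{w} n X Y := by
  induction n generalizing X with
  | zero =>
    intro ε
    obtain ⟨δ, h⟩ := h
    obtain ⟨ε', rfl⟩ := exists_push_eq_middle h ε (h₃ _)
    rw [h₁ ε', map_zero]
  | succ n ih => exact fun K P x y hP hxy => ih (h₁ x y hP hxy) (h₃ x y hP hxy)

/-- This is exactness of the long sequence at its connecting map. In degree zero an extension of `X`
by `Y''` comes from a map `K ⟶ Y''` on a syzygy `K` of `X`, and the obstruction to lifting it to `Y`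
lies in `𝔼(K, Y')`. -/
theorem ExtVanishes.right₃ (hP : HasEnoughProjectives.{w} C) {n : ℕ} {X : C}
    (h : IsTriangle.{w} f g) (h₂ : ExtVanishes.{w} n X Y) (h₁ : ExtVanishes.{w} (n + 1) X Y') :
    ExtVanishes.{w} n X Y'' := by
  induction n generalizing X with
  | zero =>
    intro ε
    obtain ⟨δ, h⟩ := h
    obtain ⟨K, P, x, y, hP, ρ, hρ⟩ := hP.exists_triangle X
    obtain ⟨a, rfl⟩ := exists_push_eq hρ ε (ext_eq_zero_of_projective hP _)
    obtain ⟨b, rfl⟩ := exists_lift h a (h₁ x y hP ⟨ρ, hρ⟩ _)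
    rw [push_comp, h₂ (𝔼.push b ρ), map_zero]
  | succ n ih => exact fun K P x y hP hxy => ih (h₂ x y hP hxy) (h₁ x y hP hxy)

theorem ExtVanishes.right₁ {n : ℕ} {X : C} (h : IsTriangle.{w} f g)
    (h₃ : ExtVanishes.{w} n X Y'') (h₂ : ExtVanishes.{w} (n + 1) X Y) :
    ExtVanishes.{w} (n + 1) X Y' := by
  induction n generalizing X with
  | zero =>
    intro K P x y hP hxy ε
    obtain ⟨δ, h⟩ := h
    obtain ⟨ρ, hρ⟩ := hxy
    obtain ⟨a, rfl⟩ := exists_pull_eq h ε (h₂ x y hP ⟨ρ, hρ⟩ _)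
    obtain ⟨b, rfl⟩ := exists_extend hρ a (h₃ _)
    rw [pull_comp, ext_eq_zero_of_projective hP (𝔼.pull b δ), map_zero]
  | succ n ih => exact fun K P x y hP hxy => ih (h₃ x y hP hxy) (h₂ x y hP hxy)

variable (hI : HasEnoughInjectives.{w} C) (hP : HasEnoughProjectives.{w} C)
include hI

theorem ExtVanishes.of_projective {P : C} (hP : projectives.{w} P) (n : ℕ) (Y : C) :
    ExtVanishes.{w} n P Y := by
  induction n generalizing Y with
  | zero => exact ext_eq_zero_of_projective hP
  | succ n ih =>
    obtain ⟨I, Z, x, y, hI, hxy⟩ := hI.exists_triangle Y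
    exact .right₁ hxy (ih Z) (.of_injective hI _ _)

theorem ExtVanishes.of_isZero_left {X : C} (hX : IsZero X) (n : ℕ) (Y : C) :
    ExtVanishes.{w} n X Y :=
  .of_projective hI (fun _ _ _ _ _ => ⟨0, hX.eq_of_src _ _⟩) n Y

variable {X' X X'' : C} {x : X' ⟶ X} {y : X ⟶ X''}

include hP

/-- Unfolding along projective presentations would change all three terms of the triangle. The
induction instead keeps the triangle and replaces `Y` by a cosyzygy; the same device serves `left₁`
and `left₃`. -/
theorem ExtVanishes.left₂ {n : ℕ} {Y : C} (h : IsTriangle.{w} x y)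
    (h₁ : ExtVanishes.{w} n X' Y) (h₃ : ExtVanishes.{w} n X'' Y) : ExtVanishes.{w} n X Y := by
  induction n generalizing Y with
  | zero =>
    intro ε
    obtain ⟨δ, h⟩ := h
    obtain ⟨ε', rfl⟩ := exists_pull_eq_middle h ε (h₁ _)
    rw [h₃ ε', map_zero]
  | succ n ih =>
    obtain ⟨I, Z, i, p, hI, hip⟩ := hI.exists_triangle Y
    have hI' := ExtVanishes.of_injective hI n
    exact .right₁ hip (ih (.right₃ hP hip (hI' _) h₁) (.right₃ hP hip (hI' _) h₃))
      (.of_injective hI _ _)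

theorem ExtVanishes.left₁ {n : ℕ} {Y : C} (h : IsTriangle.{w} x y)
    (h₂ : ExtVanishes.{w} n X Y) (h₃ : ExtVanishes.{w} (n + 1) X'' Y) :
    ExtVanishes.{w} n X' Y := by
  induction n generalizing Y with
  | zero =>
    intro ε
    obtain ⟨δ, h⟩ := h
    obtain ⟨I, Z, i, p, hI, ρ, hρ⟩ := hI.exists_triangle Y
    have h₄ : ExtVanishes.{w} 0 X'' Z := .right₃ hP ⟨ρ, hρ⟩ (.of_injective hI _ _) h₃
    obtain ⟨a, rfl⟩ := exists_pull_eq hρ ε (ext_eq_zero_of_injective hI _)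
    obtain ⟨b, rfl⟩ := exists_extend h a (h₄ _)
    rw [pull_comp, h₂ (𝔼.pull b ρ), map_zero]
  | succ n ih =>
    obtain ⟨I, Z, i, p, hI, hip⟩ := hI.exists_triangle Y
    exact .right₁ hip (ih (.right₃ hP hip (.of_injective hI _ _) h₂)
      (.right₃ hP hip (.of_injective hI _ _) h₃)) (.of_injective hI _ _)

theorem ExtVanishes.left₃ {n : ℕ} {Y : C} (h : IsTriangle.{w} x y)
    (h₁ : ExtVanishes.{w} n X' Y) (h₂ : ExtVanishes.{w} (n + 1) X Y) :
    ExtVanishes.{w} (n + 1) X'' Y := by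
  induction n generalizing Y with
  | zero =>
    obtain ⟨I, Z, i, p, hI, ρ, hρ⟩ := hI.exists_triangle Y
    have h₄ : ExtVanishes.{w} 0 X Z := .right₃ hP ⟨ρ, hρ⟩ (.of_injective hI _ _) h₂
    refine .right₁ ⟨ρ, hρ⟩ ?_ (.of_injective hI _ _)
    intro ε
    obtain ⟨δ, h⟩ := h
    obtain ⟨a, rfl⟩ := exists_push_eq h ε (h₄ _)
    obtain ⟨b, rfl⟩ := exists_lift hρ a (h₁ _)
    obtain ⟨c, rfl⟩ := hI x ⟨_, _, δ, h⟩ b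
    rw [push_comp, push_comp, push_eq_zero h, map_zero, map_zero]
  | succ n ih =>
    obtain ⟨I, Z, i, p, hI, hip⟩ := hI.exists_triangle Y
    exact .right₁ hip (ih (.right₃ hP hip (.of_injective hI _ _) h₁)
      (.right₃ hP hip (.of_injective hI _ _) h₂)) (.of_injective hI _ _)

theorem ExtVanishes.of_iso_left {n : ℕ} {Y : C} (e : X ≅ X') (h : ExtVanishes.{w} n X Y) :
    ExtVanishes.{w} n X' Y :=
  .left₂ hI hP (isTriangle_of_isIso_of_isZero e.hom (isZero_zero C) 0) h
    (.of_isZero_left hI (isZero_zero C) _ _)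

/-- `ExtVanishes` peels off the first syzygy and `IsSyzygy` the last; the free `m` lets the
induction on `n` reconcile the two orders. -/
theorem extVanishes_add_iff {n m : ℕ} {Y : C} :
    ExtVanishes.{w} (n + m) X Y ↔ ∀ Z, IsSyzygy.{w} n X Z → ExtVanishes.{w} m Z Y := by
  induction n generalizing m with
  | zero =>
    rw [Nat.zero_add]
    exact ⟨fun h Z ⟨e⟩ => h.of_iso_left hI hP e.symm, fun h => h X ⟨Iso.refl X⟩⟩
  | succ n ih =>
    rw [Nat.add_right_comm, Nat.add_assoc, ih]
    exact ⟨fun h Z ⟨W, hW, P, x, y, hP, hxy⟩ => h W hW x y hP hxy,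
      fun h W hW K P x y hP hxy => h K ⟨W, hW, P, x, y, hP, hxy⟩⟩

theorem extSuccVanishes_iff {n : ℕ} {Y : C} :
    ExtSuccVanishes.{w} n X Y ↔ ExtVanishes.{w} n X Y :=
  (extVanishes_add_iff hI hP (m := 0)).symm

end ExtVanishes

/-! ### Injective dimension and a criterion for cotilting cotorsion pairs -/

section Cotilting

variable {C : Type u} [Category.{v} C] [Preadditive C] [HasFiniteBiproducts C]
  [Extriangulated.{w} C]

open Extriangulated

theorem ExtVanishes.of_iso_right {n : ℕ} {X Y Y' : C} (e : Y ≅ Y') (h : ExtVanishes.{w} n X Y) :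
    ExtVanishes.{w} n X Y' :=
  .right₂ (isTriangle_of_isIso_of_isZero e.hom (isZero_zero C) 0) h
    (.of_isZero_right (isZero_zero C) _ _)

theorem ExtVanishes.of_le {n m : ℕ} (hnm : n ≤ m) {Y : C} (h : ∀ X, ExtVanishes.{w} n X Y)
    (X : C) : ExtVanishes.{w} m X Y := by
  induction m, hnm using Nat.le_induction generalizing X with
  | base => exact h X
  | succ m _ ih => exact fun K _ _ _ _ _ => ih K

theorem injective_of_extVanishes {Y : C} (h : ∀ X, ExtVanishes.{w} 0 X Y) :
    injectives.{w} Y := by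
  rintro A B x ⟨X, y, δ, hδ⟩ f
  exact exists_extend hδ f (h _ _)

/-- Reformulates injective dimension without choosing a coresolution, so that it can be read off
long exact sequences. -/
theorem mem_vee_injectives_iff (hI : HasEnoughInjectives.{w} C)
    (hP : HasEnoughProjectives.{w} C) {n : ℕ} {Y : C} :
    vee.{w} injectives.{w} n Y ↔ ∀ X, ExtVanishes.{w} n X Y := by
  induction n generalizing Y with
  | zero => exact ⟨fun h => .of_injective h 0, injective_of_extVanishes⟩
  | succ n ih =>
    constructor
    · rintro ⟨I, Z, x, y, hI', hZ, hxy⟩ X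
      exact .right₁ hxy (ih.1 hZ X) (.of_injective hI' _ _)
    · intro h
      obtain ⟨I, Z, x, y, hI', hxy⟩ := hI.exists_triangle Y
      exact ⟨I, Z, x, y, hI', ih.2 fun X => .right₃ hP hxy (.of_injective hI' _ _) (h X), hxy⟩

variable {U V : ObjectProperty C}

theorem IsSubcategory.of_splits (hU : IsSubcategory U) {A B X : C} {δ : Ext.{w} X A} {x : A ⟶ B}
    {y : B ⟶ X} (h : Realizes δ x y) (hδ : δ = 0) (hB : U B) : U A ∧ U X := by
  subst hδ
  obtain ⟨b, -⟩ := realizes_unique h (realizes_zero X A)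
  exact ⟨hU.summand A X (hU.iso b hB),
    hU.summand X A (hU.iso (b ≪≫ biprod.braiding A X) hB)⟩

namespace IsCotorsionPair

variable (h : IsCotorsionPair.{w} U V)
include h

theorem mem_left {X : C} (hX : ∀ Y, V Y → ∀ δ : Ext.{w} X Y, δ = 0) : U X := by
  obtain ⟨Y, Z, x, y, hY, hZ, δ, hδ⟩ := h.exists_left X
  exact (h.left.of_splits hδ (hX Y hY δ) hZ).2

theorem mem_right {Y : C} (hY : ∀ X, U X → ∀ δ : Ext.{w} X Y, δ = 0) : V Y := by
  obtain ⟨Z, X, x, y, hZ, hX, δ, hδ⟩ := h.exists_right Y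
  exact (h.right.of_splits hδ (hY X hX δ) hZ).1

theorem mem_right_of_injective {I : C} (hI : injectives.{w} I) : V I :=
  h.mem_right fun _ _ => ext_eq_zero_of_injective hI

theorem right_extension {A B X : C} {x : A ⟶ B} {y : B ⟶ X} (hxy : IsTriangle.{w} x y)
    (hA : V A) (hX : V X) : V B :=
  h.mem_right fun Z hZ => ExtVanishes.right₂ hxy (n := 0) (h.ext_zero Z A hZ hA)
    (h.ext_zero Z X hZ hX)

theorem isSubcategory_inf : IsSubcategory (U ⊓ V) where
  zero X hX := ⟨h.left.zero X hX, h.right.zero X hX⟩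
  iso e hX := ⟨h.left.iso e hX.1, h.right.iso e hX.2⟩
  sum X Y hX hY := ⟨h.left.sum X Y hX.1 hY.1, h.right.sum X Y hX.2 hY.2⟩
  summand X Y hX := ⟨h.left.summand X Y hX.1, h.right.summand X Y hX.2⟩

variable (hI : HasEnoughInjectives.{w} C) (hP : HasEnoughProjectives.{w} C)

include hP in
theorem cone_mem_right (h₂ : ∀ X Y, U X → V Y → ExtVanishes.{w} 1 X Y) {A B X : C} {x : A ⟶ B}
    {y : B ⟶ X} (hxy : IsTriangle.{w} x y) (hA : V A) (hB : V B) : V X :=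
  h.mem_right fun Z hZ => ExtVanishes.right₃ hP hxy (n := 0) (h.ext_zero Z B hZ hB)
    (h₂ Z A hZ hA)

include hI in
-- A cosyzygy of `Y` is the cone of a map from `Y` to an injective, and injectives lie in `V`.
-- Closure under cones therefore keeps every cosyzygy in `V`, and the shift reduces to `𝔼(U, V) =
-- 0`.
theorem extVanishes_of_cone_closed
    (hV : ∀ ⦃A B X : C⦄ (x : A ⟶ B) (y : B ⟶ X), IsTriangle.{w} x y → V A → V B → V X)
    (n : ℕ) {X Y : C} (hX : U X) (hY : V Y) : ExtVanishes.{w} n X Y := by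
  induction n generalizing Y with
  | zero => exact h.ext_zero X Y hX hY
  | succ n ih =>
    obtain ⟨I, Z, x, y, hI, hxy⟩ := hI.exists_triangle Y
    exact .right₁ hxy (ih (hV x y hxy hY (h.mem_right_of_injective hI))) (.of_injective hI _ _)

/-- An object of `V` all of whose `𝔼ⁿ⁺¹` into `V` vanish has a finite resolution by `U ∩ V`. -/
theorem mem_wedge (hI : HasEnoughInjectives.{w} C) (hP : HasEnoughProjectives.{w} C)
    (hU : ∀ n X Y, U X → V Y → ExtVanishes.{w} n X Y) {n : ℕ} {Y : C} (hY : V Y)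
    (hn : ∀ W, V W → ExtVanishes.{w} n Y W) : wedge.{w} (U ⊓ V) n Y := by
  induction n generalizing Y with
  | zero => exact ⟨h.mem_left hn, hY⟩
  | succ n ih =>
    obtain ⟨V', U', x, y, hV', hU', hxy⟩ := h.exists_left Y
    -- Passing from `Y` to the kernel term `V'` of its approximation lowers the degree of vanishing
    -- by one; the middle term lies in `V` by closure under extensions.
    exact ⟨V', U', x, y, ih hV' fun W hW => .left₁ hI hP hxy (hU n U' W hU' hW) (hn W hW),
      ⟨hU', h.right_extension hxy hV' hY⟩, hxy⟩

omit h in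
theorem wedge_le (hT : U ≤ V) (hV : ∀ ⦃A B X : C⦄ (x : A ⟶ B) (y : B ⟶ X),
    IsTriangle.{w} x y → V A → V B → V X) (n : ℕ) : wedge.{w} U n ≤ V := by
  induction n with
  | zero => exact hT
  | succ n ih =>
    rintro Z ⟨X, Y, x, y, hX, hY, hxy⟩
    exact hV x y hxy (ih X hX) (hT Y hY)

include hI hP in
/-- A cotorsion pair `(U, V)` with `V` closed under cones and of finite injective dimension is
cotilting. -/
theorem isCotilting
    (hV : ∀ ⦃A B X : C⦄ (x : A ⟶ B) (y : B ⟶ X), IsTriangle.{w} x y → V A → V B → V X)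
    {n : ℕ} (hn : InjDimLE.{w} V n) : IsCotiltingCotorsionPair.{w} U V := by
  have hU : ∀ n X Y, U X → V Y → ExtVanishes.{w} n X Y :=
    fun n X Y => h.extVanishes_of_cone_closed hI hV n
  -- The bound is weakened to `n + 1` because a cotilting index must be at least one, while `n` may
  -- be zero.
  have hn' : ∀ Y, V Y → ∀ X, ExtVanishes.{w} (n + 1) X Y := fun Y hY =>
    .of_le n.le_succ ((mem_vee_injectives_iff hI hP).1 (hn Y hY))
  have hw : ∀ Y, V Y → wedge.{w} (U ⊓ V) (n + 1) Y := fun Y hY =>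
    h.mem_wedge hI hP hU hY fun W hW => hn' W hW Y
  refine ⟨⟨h, fun X Y hX hY => (extSuccVanishes_iff hI hP).2 (hU 1 X Y hX hY)⟩,
    ⟨n + 1, by omega, h.isSubcategory_inf, fun Y hY => ?_, fun i _ X Y hX hY => ?_,
      fun I hI' => hw I (h.mem_right_of_injective hI')⟩, ?_, ?_⟩
  · exact (mem_vee_injectives_iff hI hP).2 (hn' Y hY.2)
  · exact (extSuccVanishes_iff hI hP).2 (hU i X Y hX.1 hY.2)
  · refine le_antisymm (fun Y hY => ⟨n + 1, hw Y hY⟩) ?_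
    rintro Y ⟨m, hY⟩
    exact wedge_le inf_le_right hV m Y hY
  · refine le_antisymm (fun X hX Y hY m => (extSuccVanishes_iff hI hP).2 (hU m X Y hX hY.2)) ?_
    intro X hX
    -- Orthogonality to `U ∩ V` in all degrees spreads along finite resolutions, hence to all of
    -- `V`.
    have key : ∀ m Y, wedge.{w} (U ⊓ V) m Y → ∀ i, ExtVanishes.{w} i X Y := by
      intro m
      induction m with
      | zero => exact fun Y hY i => (extSuccVanishes_iff hI hP).1 (hX Y hY i)
      | succ m ih =>
        rintro Z ⟨Y', T, x, y, hY', hT, hxy⟩ i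
        exact .right₃ hP hxy ((extSuccVanishes_iff hI hP).1 (hX T hT i)) (ih Y' hY' (i + 1))
    exact h.mem_left fun Y hY => key _ Y (hw Y hY) 0

end IsCotorsionPair

namespace IsCotiltingCotorsionPair

variable (h : IsCotiltingCotorsionPair.{w} U V) (hI : HasEnoughInjectives.{w} C)
  (hP : HasEnoughProjectives.{w} C)
include h hI hP

theorem cone_mem_right {A B X : C} {x : A ⟶ B} {y : B ⟶ X} (hxy : IsTriangle.{w} x y)
    (hA : V A) (hB : V B) : V X :=
  h.toIsCotorsionPair.cone_mem_right hP
    (fun X Y hX hY => (extSuccVanishes_iff hI hP).1 (h.ext_two_zero X Y hX hY)) hxy hA hB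

/-- Injective dimension at most `n` is inherited by cones, so the bound for `U ∩ V` holds uniformly
on its finite resolution closure, which is `V`. -/
theorem exists_injDimLE : ∃ n, InjDimLE.{w} V n := by
  obtain ⟨n, -, hn⟩ := h.cotilting
  refine ⟨n, ?_⟩
  have hT : ∀ Y, (U ⊓ V) Y → ∀ X, ExtVanishes.{w} n X Y := fun Y hY =>
    (mem_vee_injectives_iff hI hP).1 (hn.injDim_le Y hY)
  have key : ∀ m Y, wedge.{w} (U ⊓ V) m Y → ∀ X, ExtVanishes.{w} n X Y := by
    intro m
    induction m with
    | zero => exact hT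
    | succ m ih =>
      rintro Z ⟨Y', T, x, y, hY', hT', hxy⟩ X
      exact .right₃ hP hxy (hT T hT' X) (.of_le n.le_succ (ih Y' hY') X)
  intro Y hY
  rw [h.right_eq] at hY
  obtain ⟨m, hm⟩ := hY
  exact (mem_vee_injectives_iff hI hP).2 (key m Y hm)

end IsCotiltingCotorsionPair

end Cotilting

/-! ### Extensions under adjoint functors -/

theorem isIso_map_counit {C : Type u₁} [Category.{v₁} C] {D : Type u₂} [Category.{v₂} D]
    {F : C ⥤ D} {G : D ⥤ C} (adj : F ⊣ G) [F.Full] [F.Faithful] (Y : D) :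
    IsIso (G.map (adj.counit.app Y)) := by
  have : IsIso (adj.unit.app (G.obj Y) ≫ G.map (adj.counit.app Y)) := by
    rw [adj.right_triangle_components]
    exact inferInstanceAs (IsIso (𝟙 (G.obj Y)))
  exact IsIso.of_isIso_comp_left (adj.unit.app (G.obj Y)) _

/-- An additive functor preserves direct sums. -/
@[simps]
noncomputable def biprodMapIso {C : Type u₁} [Category.{v₁} C] [Preadditive C]
    [HasFiniteBiproducts C] {D : Type u₂} [Category.{v₂} D] [Preadditive D]
    [HasFiniteBiproducts D] (G : C ⥤ D) [G.Additive] (X Y : C) :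
    G.obj (X ⊞ Y) ≅ G.obj X ⊞ G.obj Y where
  hom := biprod.lift (G.map biprod.fst) (G.map biprod.snd)
  inv := biprod.desc (G.map biprod.inl) (G.map biprod.inr)
  hom_inv_id := by
    rw [biprod.lift_desc, ← G.map_comp, ← G.map_comp, ← G.map_add, biprod.total, G.map_id]
  inv_hom_id := by
    ext <;> simp [← G.map_comp]

section Adjunction

variable {C : Type u₁} [Category.{v₁} C] [Preadditive C] [HasFiniteBiproducts C]
  [Extriangulated.{w₁} C]
  {D : Type u₂} [Category.{v₂} D] [Preadditive D] [HasFiniteBiproducts D]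
  [Extriangulated.{w₂} D] {F : C ⥤ D} {G : D ⥤ C}

open Extriangulated

theorem IsExact.inflation (hF : IsExact.{w₁, w₂} F) {X Y : C} {f : X ⟶ Y}
    (hf : IsInflation.{w₁} f) : IsInflation.{w₂} (F.map f) := by
  obtain ⟨Z, g, h⟩ := hf
  exact ⟨F.obj Z, F.map g, hF.exact f g h⟩

theorem IsExact.deflation (hF : IsExact.{w₁, w₂} F) {X Y : C} {f : X ⟶ Y}
    (hf : IsDeflation.{w₁} f) : IsDeflation.{w₂} (F.map f) := by
  obtain ⟨Z, g, h⟩ := hf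
  exact ⟨F.obj Z, F.map g, hF.exact g f h⟩

theorem IsRightExact.deflation (hF : IsRightExact.{w₁, w₂} F) {X Y : C} {f : X ⟶ Y}
    (hf : IsDeflation.{w₁} f) : IsDeflation.{w₂} (F.map f) := by
  obtain ⟨Z, g, h⟩ := hf
  obtain ⟨K, p, q, h', -⟩ := hF.rightExact g f
    ⟨Z, 𝟙 Z, g, h, isDeflation_of_isIso _, fun _ _ => inferInstance, Category.id_comp g⟩
  exact ⟨K, q, h'⟩

theorem projectives_map (adj : F ⊣ G)
    (hG : ∀ ⦃X Y : D⦄ (f : X ⟶ Y), IsDeflation.{w₂} f → IsDeflation.{w₁} (G.map f)) {P : C}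
    (hP : projectives.{w₁} P) : projectives.{w₂} (F.obj P) := by
  intro B X y hy f
  obtain ⟨g, hg⟩ := hP (G.map y) (hG y hy) (adj.homEquiv _ _ f)
  exact ⟨(adj.homEquiv _ _).symm g, by
    rw [← adj.homEquiv_naturality_right_symm, hg, Equiv.symm_apply_apply]⟩

theorem injectives_map (adj : F ⊣ G)
    (hF : ∀ ⦃X Y : C⦄ (f : X ⟶ Y), IsInflation.{w₁} f → IsInflation.{w₂} (F.map f)) {I : D}
    (hI : injectives.{w₂} I) : injectives.{w₁} (G.obj I) := by
  intro A B x hx f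
  obtain ⟨g, hg⟩ := hI (F.map x) (hF x hx) ((adj.homEquiv _ _).symm f)
  exact ⟨adj.homEquiv _ _ g, by
    rw [← adj.homEquiv_naturality_left, hg, Equiv.apply_symm_apply]⟩

theorem HasEnoughProjectives.of_adjunction (adj : F ⊣ G)
    (hG : ∀ ⦃X Y : D⦄ (f : X ⟶ Y), IsDeflation.{w₂} f → IsDeflation.{w₁} (G.map f))
    (hF : ∀ ⦃X Y : C⦄ (f : X ⟶ Y), IsDeflation.{w₁} f → IsDeflation.{w₂} (F.map f))
    (hS : ∀ Y : D, ∃ X : C, Nonempty (F.obj X ≅ Y)) (hP : HasEnoughProjectives.{w₁} C) :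
    HasEnoughProjectives.{w₂} D := by
  intro Y
  obtain ⟨X, ⟨e⟩⟩ := hS Y
  obtain ⟨P, y, hP, hy⟩ := hP X
  exact ⟨F.obj P, F.map y ≫ e.hom, projectives_map adj hG hP,
    (hF y hy).comp (isDeflation_of_isIso _)⟩

theorem HasEnoughInjectives.of_adjunction (adj : F ⊣ G)
    (hF : ∀ ⦃X Y : C⦄ (f : X ⟶ Y), IsInflation.{w₁} f → IsInflation.{w₂} (F.map f))
    (hG : ∀ ⦃X Y : D⦄ (f : X ⟶ Y), IsInflation.{w₂} f → IsInflation.{w₁} (G.map f))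
    (hS : ∀ X : C, ∃ Y : D, Nonempty (X ≅ G.obj Y)) (hI : HasEnoughInjectives.{w₂} D) :
    HasEnoughInjectives.{w₁} C := by
  intro X
  obtain ⟨Y, ⟨e⟩⟩ := hS X
  obtain ⟨I, y, hI, hy⟩ := hI Y
  exact ⟨G.obj I, e.hom ≫ G.map y, injectives_map adj hF hI,
    (isInflation_of_isIso _).comp (hG y hy)⟩

/-- The image under `G` of a triangle realizing `ε` lets the unit at `X` lift to its middle term;
the adjoint transpose of this lift splits `ε`. -/
theorem ext_eq_zero_of_adjunction_left (adj : F ⊣ G) (hG : IsExact.{w₂, w₁} G) {X : C} {Y : D}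
    (h : ∀ δ : Ext.{w₁} X (G.obj Y), δ = 0) (ε : Ext.{w₂} (F.obj X) Y) : ε = 0 := by
  obtain ⟨Z, x, y, hε⟩ := exists_realizes ε
  obtain ⟨ρ, hρ⟩ := hG.exact x y ⟨ε, hε⟩
  obtain ⟨g, hg⟩ : ∃ g : X ⟶ G.obj Z, g ≫ G.map y = adj.unit.app X :=
    exists_lift hρ (adj.unit.app X) (h _)
  have hs : (adj.homEquiv X Z).symm g ≫ y = 𝟙 (F.obj X) := by
    rw [← adj.homEquiv_naturality_right_symm, hg, ← adj.homEquiv_id, Equiv.symm_apply_apply]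
  rw [← pull_id ε, ← hs, pull_comp, pull_eq_zero hε, map_zero]

theorem ext_eq_zero_of_adjunction_right (adj : F ⊣ G) (hF : IsExact.{w₁, w₂} F) {X : C} {Y : D}
    (h : ∀ δ : Ext.{w₂} (F.obj X) Y, δ = 0) (ε : Ext.{w₁} X (G.obj Y)) : ε = 0 := by
  obtain ⟨Z, x, y, hε⟩ := exists_realizes ε
  obtain ⟨ρ, hρ⟩ := hF.exact x y ⟨ε, hε⟩
  obtain ⟨g, hg⟩ := exists_extend hρ (adj.counit.app Y) (h _)
  have hr : x ≫ adj.unit.app Z ≫ G.map g = 𝟙 _ := by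
    rw [← adj.unit_naturality_assoc, ← G.map_comp, hg, adj.right_triangle_components]
  rw [← push_id ε, ← hr, push_comp, push_eq_zero hε, map_zero]

theorem ExtVanishes.of_adjunction_left (hI : HasEnoughInjectives.{w₂} D)
    (hPD : HasEnoughProjectives.{w₂} D) (hPC : HasEnoughProjectives.{w₁} C) (adj : F ⊣ G)
    (hF : IsExact.{w₁, w₂} F) (hG : IsExact.{w₂, w₁} G) {n : ℕ} {X : C} {Y : D}
    (h : ExtVanishes.{w₁} n X (G.obj Y)) : ExtVanishes.{w₂} n (F.obj X) Y := by
  induction n generalizing X with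
  | zero => exact ext_eq_zero_of_adjunction_left adj hG h
  | succ n ih =>
    obtain ⟨K, P, x, y, hP, hxy⟩ := hPC.exists_triangle X
    exact .left₃ hI hPD (hF.exact x y hxy) (ih (h x y hP hxy))
      (.of_projective hI (projectives_map adj (fun _ _ _ => hG.deflation) hP) _ _)

theorem ExtVanishes.of_adjunction_right (adj : F ⊣ G) (hF : IsExact.{w₁, w₂} F)
    (hG : ∀ ⦃X Y : D⦄ (f : X ⟶ Y), IsDeflation.{w₂} f → IsDeflation.{w₁} (G.map f))
    {n : ℕ} {X : C} {Y : D}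
    (h : ExtVanishes.{w₂} n (F.obj X) Y) : ExtVanishes.{w₁} n X (G.obj Y) := by
  induction n generalizing X with
  | zero => exact ext_eq_zero_of_adjunction_right adj hF h
  | succ n ih =>
    exact fun K P x y hP hxy => ih (h _ _ (projectives_map adj hG hP) (hF.exact x y hxy))

/-- A triangle `G X ⟶ V ⟶ U` lifts along a fully faithful exact left adjoint of `G` to a
triangle `X ⟶ Y ⟶ F U` with `G Y ≅ V`. -/
theorem exists_triangle_lift (adj : F ⊣ G) [F.Full] [F.Faithful] (hF : IsExact.{w₁, w₂} F)
    (hG : IsExact.{w₂, w₁} G) {X : D} {V U : C} {f : G.obj X ⟶ V} {g : V ⟶ U}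
    (h : IsTriangle.{w₁} f g) :
    ∃ (Y : D) (x : X ⟶ Y) (y : Y ⟶ F.obj U), IsTriangle.{w₂} x y ∧ Nonempty (V ≅ G.obj Y) := by
  obtain ⟨Y, k, x, y, h₁, h₂⟩ := (hF.exact f g h).exists_pushout (A' := X) (adj.counit.app X)
  refine ⟨Y, x, y, h₂, ?_⟩
  have := hG.additive
  have := isIso_map_counit adj X
  have h₃ := (hG.exact _ _ h₁).of_iso (biprodMapIso G (F.obj V) X)
    (x' := biprod.lift (G.map (F.map f)) (G.map (adj.counit.app X)))
    (y' := (biprodMapIso G (F.obj V) X).inv ≫ G.map k)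
    (by ext <;> simp [← G.map_comp]) (Iso.hom_inv_id_assoc _ _)
  -- `G` inverts the counit, so the push-out becomes trivial after `G`: its cone is the other
  -- summand `G F V`, isomorphic to `V` by the unit.
  obtain ⟨e⟩ := h₃.iso_of_isIso_snd
  exact ⟨asIso (adj.unit.app V) ≪≫ e⟩

end Adjunction

/-! ### Consequences of exactness in a recollement -/

namespace Recollement

variable {A : Type u₁} {B : Type u₂} {C : Type u₃}
    [Category.{v₁} A] [Preadditive A] [HasFiniteBiproducts A] [Extriangulated.{w₁} A]
    [Category.{v₂} B] [Preadditive B] [HasFiniteBiproducts B] [Extriangulated.{w₂} B]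
    [Category.{v₃} C] [Preadditive C] [HasFiniteBiproducts C] [Extriangulated.{w₃} C]
    (R : Recollement.{w₁, w₂, w₃} A B C)

attribute [instance] iPush_full iPush_faithful jShriek_full jShriek_faithful jPush_full
  jPush_faithful

theorem isZero_jPull_iPush (M : A) : IsZero (R.jPull.obj (R.iPush.obj M)) :=
  (R.essImage_iff _).1 (R.iPush.obj_mem_essImage M)

/-- Transposing the identity twice lands in maps out of `j^* i_*`, which is zero. -/
theorem isZero_iShriek_jPush (Z : C) : IsZero (R.iShriek.obj (R.jPush.obj Z)) := by
  rw [IsZero.iff_id_eq_zero]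
  apply (R.iShriekAdj.homEquiv _ _).symm.injective
  apply (R.jPushAdj.homEquiv _ _).symm.injective
  exact (R.isZero_jPull_iPush _).eq_of_src _ _

noncomputable def iShriekIPushIso (M : A) : M ≅ R.iShriek.obj (R.iPush.obj M) := asIso (R.iShriekAdj.unit.app M)

noncomputable def jPullJPushIso (Z : C) : R.jPull.obj (R.jPush.obj Z) ≅ Z := asIso (R.jPushAdj.counit.app Z)

include R in
theorem hasEnoughProjectives_left (hP : HasEnoughProjectives.{w₂} B) :
    HasEnoughProjectives.{w₁} A :=
  hP.of_adjunction R.iPullAdj (fun _ _ _ => R.iPush_exact.deflation)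
    (fun _ _ _ => R.iPull_rightExact.deflation)
    fun M => ⟨R.iPush.obj M, ⟨asIso (R.iPullAdj.counit.app M)⟩⟩

variable (hi : IsExact.{w₂, w₁} R.iShriek)
include hi

/-- `i^!` inverts the counit and kills `j_*`, so applying it to both triangles of (R4) shows that
`i^! i_* Y`, hence `Y`, is zero. The last term disappears and `q` becomes invertible. -/
theorem isTriangle_counit_unit (X : B) :
    IsTriangle.{w₂} (R.iShriekAdj.counit.app X) (R.jPushAdj.unit.app X) := by
  obtain ⟨Y, h, K, p, q, h₁, h₂, hpq, -⟩ := R.exists_left X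
  have := isIso_map_counit R.iShriekAdj X
  have hK := (hi.exact _ _ h₁).isZero_of_isIso
  have : IsIso (R.iShriek.map q) := hK.isIso (R.isZero_iShriek_jPush _) _
  have hY : IsZero Y := (hi.exact _ _ h₂).isZero_of_isIso.of_iso (R.iShriekIPushIso Y)
  have := R.iPush_exact.additive
  have : IsIso q := h₂.isIso_of_isZero (R.iPush.map_isZero hY)
  rw [← hpq]
  exact h₁.comp_iso (asIso q)

/-- Left exactness writes `j_* g` as a deflation followed by a compatible inflation `q`. The cone of
`q` is killed by both `j^*` and `i^!`, hence is zero. -/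
theorem jPush_deflation (hC : WIC.{w₃} C) {Y Z : C} (g : Y ⟶ Z) (hg : IsDeflation.{w₃} g) :
    IsDeflation.{w₂} (R.jPush.map g) := by
  obtain ⟨Y', f, h⟩ := hg
  obtain ⟨K, p, q, h₁, ⟨L, r, h₂⟩, hq, hpq⟩ := R.jPush_leftExact.leftExact f g
    ⟨Z, g, 𝟙 Z, h, isInflation_of_isIso _, fun _ _ => inferInstance, Category.comp_id g⟩
  have hdefl : IsDeflation.{w₃} (R.jPull.map p ≫ R.jPull.map q) := by
    have : R.jPull.map p ≫ R.jPull.map q =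
        (R.jPullJPushIso Y).hom ≫ g ≫ (R.jPullJPushIso Z).inv := by
      rw [← R.jPull.map_comp, hpq, ← Category.assoc, Iso.eq_comp_inv]
      exact R.jPushAdj.counit_naturality g
    rw [this]
    exact (isDeflation_of_isIso _).comp (.comp ⟨Y', f, h⟩ (isDeflation_of_isIso _))
  -- (WIC) makes `j^* q` a deflation because its composite with `j^* p` is `g` up to isomorphism;
  -- compatibility then inverts it.
  have : IsIso (R.jPull.map q) := R.jPull_exact.compatible q hq
    (R.jPull_exact.inflation ⟨L, r, h₂⟩) (hC.deflation _ _ hdefl)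
  obtain ⟨M, ⟨e⟩⟩ := (R.essImage_iff L).2 (R.jPull_exact.exact _ _ h₂).isZero_of_isIso
  have : IsIso (R.iShriek.map (R.jPush.map f)) :=
    (R.isZero_iShriek_jPush _).isIso (R.isZero_iShriek_jPush _) _
  have hK := (hi.exact _ _ h₁).isZero_of_isIso
  have : IsIso (R.iShriek.map q) := hK.isIso (R.isZero_iShriek_jPush _) _
  have hM : IsZero M := (hi.exact _ _ h₂).isZero_of_isIso.of_iso
    (R.iShriekIPushIso M ≪≫ R.iShriek.mapIso e)
  have := R.iPush_exact.additive
  have : IsIso q := h₂.isIso_of_isZero ((R.iPush.map_isZero hM).of_iso e.symm)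
  rw [← hpq]
  exact .comp ⟨_, _, h₁⟩ (isDeflation_of_isIso q)

theorem hasEnoughInjectives_left (hI : HasEnoughInjectives.{w₂} B) :
    HasEnoughInjectives.{w₁} A :=
  hI.of_adjunction R.iShriekAdj (fun _ _ _ => R.iPush_exact.inflation)
    (fun _ _ _ => hi.inflation) fun M => ⟨R.iPush.obj M, ⟨R.iShriekIPushIso M⟩⟩

theorem hasEnoughProjectives_right (hC : WIC.{w₃} C) (hP : HasEnoughProjectives.{w₂} B) :
    HasEnoughProjectives.{w₃} C :=
  hP.of_adjunction R.jPushAdj (fun _ _ => R.jPush_deflation hi hC)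
    (fun _ _ _ => R.jPull_exact.deflation) fun Z => ⟨R.jPush.obj Z, ⟨R.jPullJPushIso Z⟩⟩

omit hi in
theorem hasEnoughInjectives_right (hj : IsExact.{w₃, w₂} R.jShriek)
    (hI : HasEnoughInjectives.{w₂} B) : HasEnoughInjectives.{w₃} C :=
  hI.of_adjunction R.jShriekAdj (fun _ _ _ => hj.inflation)
    (fun _ _ _ => R.jPull_exact.inflation) fun Z => ⟨R.jPush.obj Z, ⟨(R.jPullJPushIso Z).symm⟩⟩

/-! ### Injective dimension across the recollement -/

section InjectiveDimension

variable (hj : IsExact.{w₃, w₂} R.jShriek) (hC : WIC.{w₃} C)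
  (hP : HasEnoughProjectives.{w₂} B) (hI : HasEnoughInjectives.{w₂} B)
include hj hC hP hI

/-- By adjunction, extensions from `j_!` into `i_* Y` vanish and those from `i_*` are controlled by
`𝔼` in `A`. The degree rises by one because the first term of (R5) reaches `X` through a connecting
map. -/
theorem extVanishes_iPush {n : ℕ} {Y : A} (hY : ∀ M, ExtVanishes.{w₁} n M Y) (X : B) :
    ExtVanishes.{w₂} (n + 1) X (R.iPush.obj Y) := by
  have h₁ : ∀ m, n ≤ m → ∀ M, ExtVanishes.{w₂} m (R.iPush.obj M) (R.iPush.obj Y) :=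
    fun m hm M => .of_adjunction_left hI hP (R.hasEnoughProjectives_left hP) R.iShriekAdj
      R.iPush_exact hi (.of_iso_right (R.iShriekIPushIso Y) (.of_le hm hY M))
  have h₂ : ∀ Z, ExtVanishes.{w₂} (n + 1) (R.jShriek.obj Z) (R.iPush.obj Y) := fun Z =>
    .of_adjunction_left hI hP (R.hasEnoughProjectives_right hi hC hP) R.jShriekAdj hj
      R.jPull_exact (.of_isZero_right (R.isZero_jPull_iPush Y) _ _)
  obtain ⟨M, f, K, p, q, hp, hq, -⟩ := R.exists_right X
  exact .left₂ hI hP hq (.left₃ hI hP hp (h₁ n le_rfl _) (h₂ _)) (h₁ _ n.le_succ _)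

omit hP hj hI in
theorem extVanishes_jPush {n : ℕ} {Y : C} (hY : ∀ Z, ExtVanishes.{w₃} n Z Y) (X : B) :
    ExtVanishes.{w₂} n X (R.jPush.obj Y) :=
  .of_adjunction_right R.jPushAdj R.jPull_exact (fun _ _ => R.jPush_deflation hi hC) (hY _)

theorem injDimLE_gluedRight {V₁ : ObjectProperty A} {V₃ : ObjectProperty C} {n₁ n₃ : ℕ}
    (h₁ : InjDimLE.{w₁} V₁ n₁) (h₃ : InjDimLE.{w₃} V₃ n₃) :
    InjDimLE.{w₂} (R.gluedRight V₁ V₃) (max (n₁ + 1) n₃) := by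
  intro X hX
  have h₁' := (mem_vee_injectives_iff (R.hasEnoughInjectives_left hi hI)
    (R.hasEnoughProjectives_left hP)).1 (h₁ _ hX.1)
  have h₃' := (mem_vee_injectives_iff (R.hasEnoughInjectives_right hj hI)
    (R.hasEnoughProjectives_right hi hC hP)).1 (h₃ _ hX.2)
  exact (mem_vee_injectives_iff hI hP).2 fun W => .right₂ (R.isTriangle_counit_unit hi X)
    (.of_le (le_max_left _ _) (R.extVanishes_iPush hi hj hC hP hI h₁') W)
    (.of_le (le_max_right _ _) (R.extVanishes_jPush hi hC h₃') W)

end InjectiveDimension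

/-! ### The glued cotorsion pair -/

section Gluing

variable {U₁ V₁ : ObjectProperty A} {U₃ V₃ : ObjectProperty C}

theorem isSubcategory_gluedRight (h₁ : IsSubcategory V₁) (h₃ : IsSubcategory V₃) :
    IsSubcategory (R.gluedRight V₁ V₃) := by
  have := hi.additive
  have := R.jPull_exact.additive
  exact
    { zero X hX := ⟨h₁.zero _ (R.iShriek.map_isZero hX), h₃.zero _ (R.jPull.map_isZero hX)⟩
      iso e hX := ⟨h₁.iso (R.iShriek.mapIso e) hX.1, h₃.iso (R.jPull.mapIso e) hX.2⟩
      sum X Y hX hY := ⟨h₁.iso (biprodMapIso R.iShriek X Y).symm (h₁.sum _ _ hX.1 hY.1),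
        h₃.iso (biprodMapIso R.jPull X Y).symm (h₃.sum _ _ hX.2 hY.2)⟩
      summand X Y hX := ⟨h₁.summand _ _ (h₁.iso (biprodMapIso R.iShriek X Y) hX.1),
        h₃.summand _ _ (h₃.iso (biprodMapIso R.jPull X Y) hX.2)⟩ }

omit hi in
theorem isSubcategory_leftPerpOne (V : ObjectProperty B) :
    IsSubcategory (leftPerpOne.{w₂} V) := by
  have key : ∀ {X X' : B} (s : X ⟶ X') (r : X' ⟶ X), s ≫ r = 𝟙 X → leftPerpOne.{w₂} V X' →
      leftPerpOne.{w₂} V X := fun s r hsr hX Y hY δ => by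
    rw [← pull_id δ, ← hsr, pull_comp, hX Y hY (Extriangulated.𝔼.pull r δ), map_zero]
  exact
    { zero X hX Y _ δ := by rw [← pull_id δ, hX.eq_of_src (𝟙 X) 0, pull_zero]
      iso e hX := key e.inv e.hom e.inv_hom_id hX
      sum X Y hX hY Z hZ δ := by
        obtain ⟨ε, rfl⟩ := exists_pull_eq_middle (Extriangulated.realizes_zero Y X) δ (hX Z hZ _)
        rw [hY Z hZ ε, map_zero]
      summand X Y hX := key biprod.inl biprod.fst (by simp) hX }

omit hi in
theorem leftPerpOne_extension {V : ObjectProperty B} {X' X X'' : B} {x : X' ⟶ X} {y : X ⟶ X''}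
    (h : IsTriangle.{w₂} x y) (h' : leftPerpOne.{w₂} V X') (h'' : leftPerpOne.{w₂} V X'') :
    leftPerpOne.{w₂} V X := by
  intro Y hY δ
  obtain ⟨ρ, h⟩ := h
  obtain ⟨ε, rfl⟩ := exists_pull_eq_middle h δ (h' Y hY _)
  rw [h'' Y hY ε, map_zero]

theorem isCotorsionPair_glued (hj : IsExact.{w₃, w₂} R.jShriek)
    (hP : HasEnoughProjectives.{w₂} B) (h₁ : IsCotorsionPair.{w₁} U₁ V₁)
    (h₃ : IsCotorsionPair.{w₃} U₃ V₃) :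
    IsCotorsionPair.{w₂} (R.gluedLeft V₁ V₃) (R.gluedRight V₁ V₃) := by
  have hU₁ : ∀ M, U₁ M → R.gluedLeft V₁ V₃ (R.iPush.obj M) := fun M hM Y hY =>
    ext_eq_zero_of_adjunction_left R.iShriekAdj hi (h₁.ext_zero _ _ hM hY.1)
  have hU₃ : ∀ Z, U₃ Z → R.gluedLeft V₁ V₃ (R.jShriek.obj Z) := fun Z hZ Y hY =>
    ext_eq_zero_of_adjunction_left R.jShriekAdj R.jPull_exact (h₃.ext_zero _ _ hZ hY.2)
  have hright : ∀ X, CoCone.{w₂} (R.gluedRight V₁ V₃) (R.gluedLeft V₁ V₃) X := by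
    intro X
    -- The order matters: the correction by `j_! U` may change `i^!`, whereas the later one by `i_*
    -- U'` leaves `j^*` unchanged.
    obtain ⟨V, U, f, g, hV, hU, hfg⟩ := h₃.exists_right (R.jPull.obj X)
    obtain ⟨Y, x, y, hxy, ⟨e⟩⟩ := exists_triangle_lift R.jShriekAdj hj R.jPull_exact hfg
    obtain ⟨V', U', f', g', hV', hU', hfg'⟩ := h₁.exists_right (R.iShriek.obj Y)
    obtain ⟨Z, x', y', hxy', ⟨e'⟩⟩ := exists_triangle_lift R.iShriekAdj R.iPush_exact hi hfg'
    obtain ⟨E, k, d, d', hk, hd⟩ := exists_cone_comp hxy hxy'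
    have : IsIso (R.jPull.map x') :=
      (R.jPull_exact.exact _ _ hxy').isIso_of_isZero (R.isZero_jPull_iPush U')
    exact ⟨Z, E, x ≫ x', k, ⟨h₁.right.iso e' hV',
      h₃.right.iso (e ≪≫ asIso (R.jPull.map x')) hV⟩,
      leftPerpOne_extension hd (hU₃ U hU) (hU₁ U' hU'), hk⟩
  refine ⟨isSubcategory_leftPerpOne _, R.isSubcategory_gluedRight hi h₁.right h₃.right,
    fun X Y hX hY => hX Y hY, fun X => ?_, hright⟩
  -- Salce's trick: the push-out of a projective presentation of `X` and a right approximation of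
  -- the syzygy `K` is both an extension of `X` by `V` and an extension of `U` by `P`.
  obtain ⟨K, P, k, p, hP', hkp⟩ := hP.exists_triangle X
  obtain ⟨V, U, v, u, hV, hU, hvu⟩ := hright K
  obtain ⟨E, E', i, q, i', q', hiq, hiq', ⟨e⟩⟩ := hkp.exists_pushout_square hvu
  exact ⟨V, E, i, q, hV, (isSubcategory_leftPerpOne _).iso e.symm
    (leftPerpOne_extension hiq' (fun Y _ => ext_eq_zero_of_projective hP') hU), hiq⟩

end Gluing

end Recollement

end Extri

theorem mainTheorem2 {k : Type u} [Field k]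
    {A : Type u₁} {B : Type u₂} {C : Type u₃}
    [Category.{v₁} A] [Preadditive A] [Linear k A] [HasFiniteBiproducts A]
    [Extri.Extriangulated.{w₁} A]
    [Category.{v₂} B] [Preadditive B] [Linear k B] [HasFiniteBiproducts B]
    [Extri.Extriangulated.{w₂} B]
    [Category.{v₃} C] [Preadditive C] [Linear k C] [HasFiniteBiproducts C]
    [Extri.Extriangulated.{w₃} C]
    (hA : Extri.StandingConventions.{w₁} k A)
    (hB : Extri.StandingConventions.{w₂} k B)
    (hC : Extri.StandingConventions.{w₃} k C)
    (R : Extri.Recollement.{w₁, w₂, w₃} A B C)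
    (hproj : Extri.HasEnoughProjectives.{w₂} B)
    (hinj : Extri.HasEnoughInjectives.{w₂} B)
    (hi : Extri.IsExact.{w₂, w₁} R.iShriek)
    (hj : Extri.IsExact.{w₃, w₂} R.jShriek)
    (U₁ V₁ : ObjectProperty A) (U₃ V₃ : ObjectProperty C)
    (h₁ : Extri.IsCotiltingCotorsionPair.{w₁} U₁ V₁)
    (h₃ : Extri.IsCotiltingCotorsionPair.{w₃} U₃ V₃) :
    Extri.IsCotiltingCotorsionPair.{w₂} (R.gluedLeft V₁ V₃) (R.gluedRight V₁ V₃) ∧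
      ∀ n₁ n₃ : ℕ, Extri.InjDimLE.{w₁} V₁ n₁ → Extri.InjDimLE.{w₃} V₃ n₃ →
        Extri.InjDimLE.{w₂} (R.gluedRight V₁ V₃) (max (n₁ + 1) n₃) := by
  have hPA := R.hasEnoughProjectives_left hproj
  have hIA := R.hasEnoughInjectives_left hi hinj
  have hPC := R.hasEnoughProjectives_right hi hC.wic hproj
  have hIC := R.hasEnoughInjectives_right hj hinj
  obtain ⟨n₁, hn₁⟩ := h₁.exists_injDimLE hIA hPA
  obtain ⟨n₃, hn₃⟩ := h₃.exists_injDimLE hIC hPC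
  have hdim := fun n₁ n₃ => R.injDimLE_gluedRight (V₁ := V₁) (V₃ := V₃) (n₁ := n₁) (n₃ := n₃)
    hi hj hC.wic hproj hinj
  exact ⟨(R.isCotorsionPair_glued hi hj hproj h₁.toIsCotorsionPair h₃.toIsCotorsionPair).isCotilting
    -- Closure of the glued class under cones is checked after applying the exact functors `i^!` and
    -- `j^*`.
    hinj hproj (fun X Y Z x y hxy hX hY =>
      ⟨h₁.cone_mem_right hIA hPA (hi.exact x y hxy) hX.1 hY.1,
        h₃.cone_mem_right hIC hPC (R.jPull_exact.exact x y hxy) hX.2 hY.2⟩)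
    (hdim n₁ n₃ hn₁ hn₃), hdim⟩
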